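/- **Setting.** Terms are built from variables, integers, the arithmetic operations $+,-,\cdot,/$ (and unary minus) and arbitrary further function symbols. Arithmetic is over the integers; division is truncating and undefined for divisor $0$. A program $P$ is a set of clauses $H\leftarrow B_1,\dots,B_n$, where $H$ is an atom of a user-defined predicate and each $B_i$ is an atom of a user-defined predicate, a comparison $e_1\mathrel{\rho}e_2$ with $\rho\in\{>,<,\ge,\le\}$, or a call $t\ \mathit{is}\ e$. A query $Q$ is a finite sequence of such $B_i$. In an LD-derivation the leftmost atom is always selected; a user-defined atom is resolved with a variant of a clause, standardised apart, by a most general unifier; a comparison succeeds if both sides can be evaluated and the relation holds; $t\ \mathit{is}\ e$ unifies $t$ with the value of $e$; a built-in that cannot be evaluated ends the derivation without success. The Bossi–Cocco semantics is $$\mathcal M[\![P]\!](Q)=\{\sigma\mid\text{there is a successful LD-derivation of }Q\text{ and }P\text{ with computed answer substitution }\sigma\}\cup\{\bot\mid\text{there is an infinite LD-derivation of }Q\text{ and }P\}.$$ Predicates $p,q$ are mutually recursive, $p\simeq q$, if each depends on the other in the reflexive transitive closure of "some clause has $p$ in its head and $q$ in its body". **Adornments.** An argument position of $q$ is an *integer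 argument position* if it is occupied by an integer in every atom of $q$ that is selected in an LD-derivation of $Q$ and $P$. A *symbolic condition* over the integer arguments of $q$ is a propositional formula built from inequalities between numerical expressions over the integer argument positions $\$i$ of $q$. (An inequality with an undefined side is not true.) A *set of adornments* for $q$ is a finite set $\mathcal A_q$ of symbolic conditions over the integer arguments of $q$ that are pairwise disjoint and whose disjunction is true, for all integer values of the $\$i$. **Transformation.** Let $R$ be a set of predicates ($R=\{\mathrm{rel}(Q)\}$ for an atomic query $Q$), let $E$ be the set of predicates mutually recursive with some element of $R$, and let $\mathcal A_q$ be a set of adornments for each $q\in E$. The maximal prefix of a rule is the longest initial segment of its body that consists of comparisons of numerical expressions all of whose variables occur in the head. The adorned program $P^a$ consists of all rules that are obtained from a rule of $P$ by replacing every body atom $q(\bar t)$ with $q\in E$ by $q^A(\bar t)$ for some $A\in\mathcal A_q$, and likewise the head, if its predicate $q$ is in $E$, by an adorned head $q^A(\bar t)$, $A\in\mathcal A_q$, provided that the rule is consistent: some assignment of integers to its variables makes true all comparisons of its maximal prefix and, for every adorned atom $q^A(\bar t)$ in its body and head, the instance of $A$ in which $\$i$ stands for the value of $t_i$ (an argument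 without an arithmetic value imposes no restriction, i.e. counts as an unknown integer). The program $P^{ag}$ is $P^a$ together with the bridging clauses $q(X_1,\dots,X_n)\leftarrow q^A(X_1,\dots,X_n)$ for all $q\in E$ and $A\in\mathcal A_q$. **Theorem.** For every program $P$, query $Q$, set $R$ of predicates and sets of adornments $\mathcal A_q$ ($q\in E$), $$\mathcal M[\![P]\!](Q)=\mathcal M[\![P^{ag}]\!](Q).$$ That is, $Q$ has the same computed answer substitutions with respect to $P$ and $P^{ag}$, and it has an infinite LD-derivation with respect to $P$ if and only if it has one with respect to $P^{ag}$. -/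

import Mathlib

namespace LogicProg

/-! ### Terms and arithmetic -/

/-- The four binary operations of arithmetic. -/
inductive ArithOp where
  | add | sub | mul | div

/-- Integer arithmetic; division is truncating and is undefined for the divisor `0`. -/
def ArithOp.eval : ArithOp → ℤ → ℤ → Option ℤ
  | .add, x, y => some (x + y)
  | .sub, x, y => some (x - y)
  | .mul, x, y => some (x * y)
  | .div, x, y => if y = 0 then none else some (x.tdiv y)

/-- The four comparison relations `>`, `<`, `≥`, `≤`. -/
inductive CmpRel where
  | gt | lt | ge | le

def CmpRel.Holds : CmpRel → ℤ → ℤ → Prop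
  | .gt, x, y => x > y
  | .lt, x, y => x < y
  | .ge, x, y => x ≥ y
  | .le, x, y => x ≤ y

/-- First-order terms over variables `0, 1, 2, …`, the integers, the arithmetic function symbols,
and further function symbols taken from `F`. -/
inductive Term (F : Type*) where
  | var (x : ℕ)
  | int (z : ℤ)
  | neg (a : Term F)
  | op (o : ArithOp) (a b : Term F)
  | fn (f : F) (k : ℕ) (args : Fin k → Term F)

namespace Term

variable {F : Type*}

/-- Simultaneous replacement of variables by terms. -/
def subst (θ : ℕ → Term F) : Term F → Term F
  | var x => θ x
  | int z => int z
  | neg a => neg (a.subst θ)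
  | op o a b => op o (a.subst θ) (b.subst θ)
  | fn f k args => fn f k (fun i => (args i).subst θ)

/-- The variables occurring in a term. -/
def vars : Term F → Finset ℕ
  | var x => {x}
  | int _ => ∅
  | neg a => a.vars
  | op _ a b => a.vars ∪ b.vars
  | fn _ _ args => Finset.univ.biUnion (fun i => (args i).vars)

/-- Is the term a numerical expression, i.e. built from integers, variables and arithmetic? -/
def isNumExpr : Term F → Bool
  | var _ => true
  | int _ => true
  | neg a => a.isNumExpr
  | op _ a b => a.isNumExpr && b.isNumExpr
  | fn _ _ _ => false

/-- Arithmetic value of a term under a partial assignment of integers to variables;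
`none` if the term has no value. -/
def eval (ν : ℕ → Option ℤ) : Term F → Option ℤ
  | var x => ν x
  | int z => some z
  | neg a => (a.eval ν).map (fun x => -x)
  | op o a b => (a.eval ν).bind (fun x => (b.eval ν).bind (fun y => o.eval x y))
  | fn _ _ _ => none

/-- Run-time evaluation, where an uninstantiated variable has no value. -/
def value (t : Term F) : Option ℤ := t.eval (fun _ => none)

end Term

/-! ### Substitutions -/

/-- A substitution: only finitely many variables are moved. -/
@[ext]
structure Subst (F : Type*) where
  toFun : ℕ → Term F
  finite_support : {x | toFun x ≠ Term.var x}.Finite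

namespace Subst

variable {F : Type*}

/-- The identity substitution. -/
def id : Subst F := ⟨Term.var, by simp⟩

/-- The composition `σθ`: first `σ`, then `θ`. -/
def comp (σ θ : Subst F) : Subst F where
  toFun x := (σ.toFun x).subst θ.toFun
  finite_support := by
    refine (σ.finite_support.union θ.finite_support).subset ?_
    intro x hx
    by_contra h
    simp only [Set.mem_union, Set.mem_ofPred_eq, not_or, not_not] at h
    exact hx (by rw [h.1]; exact h.2)

/-- Restriction to a set of variables. -/
def restrict (σ : Subst F) (V : Finset ℕ) : Subst F where
  toFun x := if x ∈ V then σ.toFun x else Term.var x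
  finite_support := by
    refine σ.finite_support.subset ?_
    intro x hx h
    exact hx (by by_cases hV : x ∈ V <;> simp [hV, h])

/-- The variables moved by a substitution, and those occurring in their images. -/
def vars (σ : Subst F) : Set ℕ :=
  {y | ∃ x, σ.toFun x ≠ Term.var x ∧ (y = x ∨ y ∈ (σ.toFun x).vars)}

end Subst

/-! ### Atoms, clauses, programs

`ar : Pr → ℕ` gives the arities of the (user-defined) predicate symbols in `Pr`. -/

section

variable (F : Type*) {Pr : Type*} (ar : Pr → ℕ)

/-- A user-defined predicate applied to terms. -/
@[ext]
structure Atom where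
  rel : Pr
  args : Fin (ar rel) → Term F

/-- The atoms allowed in bodies and queries: a user-defined atom, an arithmetic comparison,
or a call `t is e` of the built-in arithmetic assignment. -/
inductive Literal where
  | atom (A : Atom F ar)
  | cmp (r : CmpRel) (a b : Term F)
  | assign (t e : Term F)

/-- A clause `head ← body`. -/
structure Clause where
  head : Atom F ar
  body : List (Literal F ar)

abbrev Program := Set (Clause F ar)

abbrev Query := List (Literal F ar)

end

section

variable {F : Type*} {Pr : Type*} {ar : Pr → ℕ}

def Atom.subst (θ : ℕ → Term F) (A : Atom F ar) : Atom F ar :=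
  ⟨A.rel, fun i => (A.args i).subst θ⟩

def Atom.vars (A : Atom F ar) : Finset ℕ := Finset.univ.biUnion (fun i => (A.args i).vars)

def Literal.subst (θ : ℕ → Term F) : Literal F ar → Literal F ar
  | .atom A => .atom (A.subst θ)
  | .cmp r a b => .cmp r (a.subst θ) (b.subst θ)
  | .assign t e => .assign (t.subst θ) (e.subst θ)

def Literal.vars : Literal F ar → Finset ℕ
  | .atom A => A.vars
  | .cmp _ a b => a.vars ∪ b.vars
  | .assign t e => t.vars ∪ e.vars

def Query.vars (Q : Query F ar) : Finset ℕ := Q.foldr (fun L V => L.vars ∪ V) ∅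

def Clause.vars (r : Clause F ar) : Finset ℕ := r.head.vars ∪ Query.vars r.body

/-- The variant of a clause obtained by a renaming of variables. -/
def Clause.rename (ρ : Equiv.Perm ℕ) (r : Clause F ar) : Clause F ar :=
  ⟨r.head.subst (fun x => .var (ρ x)), r.body.map (Literal.subst (fun x => .var (ρ x)))⟩

/-! ### Mutual recursion -/

/-- `p` refers to `q` in `P`: some clause has `p` in its head and `q` in its body. -/
def RefersTo (P : Program F ar) (p q : Pr) : Prop :=
  ∃ r ∈ P, r.head.rel = p ∧ ∃ A : Atom F ar, Literal.atom A ∈ r.body ∧ A.rel = q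

/-- `p` depends on `q` in `P`. -/
def DependsOn (P : Program F ar) (p q : Pr) : Prop :=
  Relation.ReflTransGen (RefersTo P) p q

/-- `p` and `q` are mutually recursive in `P`. -/
def MutRec (P : Program F ar) (p q : Pr) : Prop := DependsOn P p q ∧ DependsOn P q p

/-! ### LD-derivations -/

/-- `θ` is a most general unifier of two objects on which substitutions act through `act`. -/
def IsMGU {α : Type*} (act : (ℕ → Term F) → α → α) (θ : Subst F) (a b : α) : Prop :=
  act θ.toFun a = act θ.toFun b ∧
    ∀ η : Subst F, act η.toFun a = act η.toFun b → ∃ γ : Subst F, η = θ.comp γ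

/-- A stage of an LD-derivation: the current query, the variables used so far (in the initial
query, in the input clauses and in the unifiers) and the composition of the unifiers so far. -/
structure Config (F : Type*) {Pr : Type*} (ar : Pr → ℕ) where
  goal : Query F ar
  used : Set ℕ
  answer : Subst F

def Config.init (Q : Query F ar) : Config F ar := ⟨Q, ↑(Query.vars Q), Subst.id⟩

/-- One LD-derivation step (leftmost selection). A user-defined atom is resolved with a variant,
standardised apart, of a clause of the program. A comparison succeeds if both sides have values
standing in the relation. A call `t is e` unifies `t` with the value of `e`. A built-in whose
arguments cannot be evaluated ends the derivation without success. -/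
inductive Step (P : Program F ar) : Config F ar → Config F ar → Prop
  | resolve (A : Atom F ar) (G : Query F ar) (V : Set ℕ) (σ θ : Subst F)
      (r : Clause F ar) (ρ : Equiv.Perm ℕ) (hr : r ∈ P)
      (hfresh : Disjoint (↑(r.rename ρ).vars : Set ℕ) V)
      (hθ : IsMGU Atom.subst θ A (r.rename ρ).head) :
      Step P ⟨.atom A :: G, V, σ⟩
        ⟨((r.rename ρ).body ++ G).map (Literal.subst θ.toFun),
          V ∪ ↑(r.rename ρ).vars ∪ θ.vars, σ.comp θ⟩
  | cmp (c : CmpRel) (a b : Term F) (x y : ℤ) (G : Query F ar) (V : Set ℕ) (σ : Subst F)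
      (ha : a.value = some x) (hb : b.value = some y) (hc : c.Holds x y) :
      Step P ⟨.cmp c a b :: G, V, σ⟩ ⟨G, V, σ⟩
  | assign (t e : Term F) (z : ℤ) (G : Query F ar) (V : Set ℕ) (σ θ : Subst F)
      (he : e.value = some z) (hθ : IsMGU Term.subst θ t (.int z)) :
      Step P ⟨.assign t e :: G, V, σ⟩
        ⟨G.map (Literal.subst θ.toFun), V ∪ θ.vars, σ.comp θ⟩

/-- The stages that occur in LD-derivations of `Q` and `P`. -/
def Reachable (P : Program F ar) (Q : Query F ar) (C : Config F ar) : Prop :=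
  Relation.ReflTransGen (Step P) (Config.init Q) C

/-- `σ` is the computed answer substitution of a successful LD-derivation of `Q` and `P`. -/
def IsComputedAnswer (P : Program F ar) (Q : Query F ar) (σ : Subst F) : Prop :=
  ∃ C : Config F ar, Reachable P Q C ∧ C.goal = [] ∧ σ = C.answer.restrict (Query.vars Q)

/-- There is an infinite LD-derivation of `Q` and `P`. -/
def HasInfiniteDerivation (P : Program F ar) (Q : Query F ar) : Prop :=
  ∃ C : ℕ → Config F ar, C 0 = Config.init Q ∧ ∀ n, Step P (C n) (C (n + 1))

/-- The Bossi–Cocco semantics `𝓜[[P]](Q)`: the computed answer substitutions, together with `⊥`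
if there is an infinite LD-derivation. -/
def bossiCocco (P : Program F ar) (Q : Query F ar) : Set (WithBot (Subst F)) :=
  {a | ∃ σ : Subst F, IsComputedAnswer P Q σ ∧ a = (σ : WithBot (Subst F))} ∪
    {a | a = ⊥ ∧ HasInfiniteDerivation P Q}

/-- `A ∈ Call(P, Q)`: the atom `A` is selected at some stage of an LD-derivation of `Q`. -/
def IsCall (P : Program F ar) (Q : Query F ar) (A : Atom F ar) : Prop :=
  ∃ C : Config F ar, Reachable P Q C ∧ ∃ G, C.goal = .atom A :: G

/-- The `i`-th argument position of `q` is an integer argument position: it holds an integer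
in every call of `q`. -/
def IsIntegerPosition (P : Program F ar) (Q : Query F ar) (q : Pr) (i : Fin (ar q)) : Prop :=
  ∀ args : Fin (ar q) → Term F, IsCall P Q ⟨q, args⟩ → ∃ z : ℤ, args i = .int z

end

/-! ### Symbolic conditions and adornments -/

/-- Numerical expressions over the argument positions denominators `$1, …, $n`. -/
inductive SymExpr (n : ℕ) where
  | pos (i : Fin n)
  | int (z : ℤ)
  | neg (a : SymExpr n)
  | op (o : ArithOp) (a b : SymExpr n)

/-- Symbolic conditions: propositional formulae based on symbolic inequalities. -/
inductive SymCond (n : ℕ) where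
  | ineq (r : CmpRel) (a b : SymExpr n)
  | tru
  | not (c : SymCond n)
  | and (c d : SymCond n)
  | or (c d : SymCond n)

def SymExpr.eval {n : ℕ} (d : Fin n → ℤ) : SymExpr n → Option ℤ
  | pos i => some (d i)
  | int z => some z
  | neg a => (a.eval d).map (fun x => -x)
  | op o a b => (a.eval d).bind (fun x => (b.eval d).bind (fun y => o.eval x y))

def SymExpr.positions {n : ℕ} : SymExpr n → Set (Fin n)
  | pos i => {i}
  | int _ => ∅
  | neg a => a.positions
  | op _ a b => a.positions ∪ b.positions

/-- Truth of a symbolic condition at given integer values of the argument positions; an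
inequality one of whose sides has no value is not true. -/
def SymCond.Holds {n : ℕ} (d : Fin n → ℤ) : SymCond n → Prop
  | ineq r a b => ∃ x y, a.eval d = some x ∧ b.eval d = some y ∧ r.Holds x y
  | tru => True
  | not c => ¬ c.Holds d
  | and c e => c.Holds d ∧ e.Holds d
  | or c e => c.Holds d ∨ e.Holds d

/-- The argument positions whose denominators occur in a symbolic condition. -/
def SymCond.positions {n : ℕ} : SymCond n → Set (Fin n)
  | ineq _ a b => a.positions ∪ b.positions
  | tru => ∅
  | not c => c.positions
  | and c e => c.positions ∪ e.positions
  | or c e => c.positions ∪ e.positions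

/-- Predicate symbols of the adorned program: the original ones, `Sum.inl p`, and the adorned
ones `p^c`, written `Sum.inr ⟨p, c⟩`. -/
abbrev AdPred {Pr : Type*} (ar : Pr → ℕ) := Pr ⊕ (Σ p : Pr, SymCond (ar p))

/-- Adorning a predicate does not change its arity. -/
def adAr {Pr : Type*} (ar : Pr → ℕ) : AdPred ar → ℕ
  | .inl p => ar p
  | .inr a => ar a.1

section

variable {F : Type*} {Pr : Type*} {ar : Pr → ℕ}

/-- `S` is a set of adornments for `q`: symbolic conditions over the integer arguments of `q`
that are pairwise disjoint and whose disjunction is true. -/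
def IsSetOfAdornments (P : Program F ar) (Q : Query F ar) (q : Pr)
    (S : Finset (SymCond (ar q))) : Prop :=
  (∀ c ∈ S, ∀ i ∈ c.positions, IsIntegerPosition P Q q i) ∧
  (∀ c ∈ S, ∀ c' ∈ S, c ≠ c' → ∀ d : Fin (ar q) → ℤ, ¬ (c.Holds d ∧ c'.Holds d)) ∧
  (∀ d : Fin (ar q) → ℤ, ∃ c ∈ S, c.Holds d)

/-! ### Consistency with the maximal prefix -/

/-- The comparison may occur in a prefix of a rule with head variables `V`: it is an integer
inequality all of whose variables are in `V`. -/
def Literal.isPrefixInequality (V : Finset ℕ) : Literal F ar → Bool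
  | .cmp _ a b => a.isNumExpr && b.isNumExpr && decide (a.vars ∪ b.vars ⊆ V)
  | _ => false

/-- The maximal prefix of a rule (empty if the rule has no prefix). -/
def Clause.maxPrefix (r : Clause F ar) : List (Literal F ar) :=
  r.body.takeWhile (Literal.isPrefixInequality r.head.vars)

/-- Truth of a comparison under an integer assignment to the variables. -/
def Literal.CmpTrue (ν : ℕ → ℤ) : Literal F ar → Prop
  | .cmp c a b => ∃ x y, a.eval (fun v => some (ν v)) = some x ∧
      b.eval (fun v => some (ν v)) = some y ∧ c.Holds x y
  | _ => True

/-- Truth, under an integer assignment to the variables, of the instance of the adornment of an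
adorned atom with respect to that atom: each denominator stands for the value of the
corresponding argument. An argument without an arithmetic value imposes no restriction, i.e. it is
treated as an unknown integer. An atom that is not adorned carries no condition. -/
def Atom.AdornmentTrue (ν : ℕ → ℤ) : Atom F (adAr ar) → Prop
  | ⟨.inl _, _⟩ => True
  | ⟨.inr a, args⟩ => ∃ d : Fin (ar a.1) → ℤ,
      (∀ (i : Fin (ar a.1)) (z : ℤ),
        Term.eval (fun v => some (ν v)) (args i) = some z → d i = z) ∧
      a.2.Holds d

/-- The adornments in the head and in the body of the rule and the comparisons of its maximal
prefix are together consistent, i.e. jointly satisfiable over the integers. -/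
def Clause.Consistent (r : Clause F (adAr ar)) : Prop :=
  ∃ ν : ℕ → ℤ, (∀ L ∈ r.maxPrefix, L.CmpTrue ν) ∧
    (∀ A, Literal.atom A ∈ r.body → A.AdornmentTrue ν) ∧ r.head.AdornmentTrue ν

/-! ### The adorned program -/

/-- `AdornAtom E 𝒜 A A'`: the atom `A'` is `q^c(t₁,…,tₙ)` for some `c ∈ 𝒜 q` if `A = q(t₁,…,tₙ)`
with `q ∈ E`, and it is `A` itself if `q ∉ E`. -/
inductive AdornAtom (E : Set Pr) (𝒜 : (q : Pr) → Finset (SymCond (ar q))) :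
    Atom F ar → Atom F (adAr ar) → Prop
  | keep (q : Pr) (args : Fin (ar q) → Term F) (hq : q ∉ E) :
      AdornAtom E 𝒜 ⟨q, args⟩ ⟨.inl q, args⟩
  | adorn (q : Pr) (args : Fin (ar q) → Term F) (hq : q ∈ E)
      (c : SymCond (ar q)) (hc : c ∈ 𝒜 q) :
      AdornAtom E 𝒜 ⟨q, args⟩ ⟨.inr ⟨q, c⟩, args⟩

/-- Adorning of a body atom; built-ins are not changed. -/
inductive AdornLiteral (E : Set Pr) (𝒜 : (q : Pr) → Finset (SymCond (ar q))) :
    Literal F ar → Literal F (adAr ar) → Prop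
  | atom (A : Atom F ar) (A' : Atom F (adAr ar)) (h : AdornAtom E 𝒜 A A') :
      AdornLiteral E 𝒜 (.atom A) (.atom A')
  | cmp (c : CmpRel) (a b : Term F) : AdornLiteral E 𝒜 (.cmp c a b) (.cmp c a b)
  | assign (t e : Term F) : AdornLiteral E 𝒜 (.assign t e) (.assign t e)

/-- The predicates to be adorned: those mutually recursive with a predicate in `R`. -/
def adornedPreds (P : Program F ar) (R : Set Pr) : Set Pr := {q | ∃ p ∈ R, MutRec P p q}

/-- The program `P^a` adorned with respect to the predicates in `R`: all the consistent rules
obtained from rules of `P` by adorning body atoms and heads. -/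
def adornedProgram (P : Program F ar) (R : Set Pr) (𝒜 : (q : Pr) → Finset (SymCond (ar q))) :
    Program F (adAr ar) :=
  {r' | ∃ r ∈ P, AdornAtom (adornedPreds P R) 𝒜 r.head r'.head ∧
    List.Forall₂ (AdornLiteral (adornedPreds P R) 𝒜) r.body r'.body ∧ r'.Consistent}

/-- The bridging clause `q(X₁,…,Xₙ) ← q^c(X₁,…,Xₙ)`. -/
def bridgingClause (F : Type*) (q : Pr) (c : SymCond (ar q)) : Clause F (adAr ar) :=
  ⟨⟨.inl q, fun i => .var i⟩, [.atom ⟨.inr ⟨q, c⟩, fun i => .var i⟩]⟩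

/-- The extended program `P^{ag}`. -/
def extendedProgram (P : Program F ar) (R : Set Pr) (𝒜 : (q : Pr) → Finset (SymCond (ar q))) :
    Program F (adAr ar) :=
  adornedProgram P R 𝒜 ∪ {r | ∃ q ∈ adornedPreds P R, ∃ c ∈ 𝒜 q, r = bridgingClause F q c}

/-- A literal of the original language, read in the language of the adorned program. -/
def Literal.embed : Literal F ar → Literal F (adAr ar)
  | .atom A => .atom ⟨.inl A.rel, A.args⟩
  | .cmp c a b => .cmp c a b
  | .assign t e => .assign t e

/-- A query of the original language, read in the language of the adorned program. -/
def Query.embed (Q : Query F ar) : Query F (adAr ar) := Q.map Literal.embed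

end

end LogicProg

/-!
The transformation only inserts guesses about integer values into a derivation, so both inclusions
are simulations of LD-derivations.

Names of variables are disposed of first. Two configurations are *variants* if each is an instance
of the other, with respect to the goal and to the values of the variables of the initial query.
Being variants is a bisimulation for derivation steps (`Step.exists_variant`, which rests on the
lifting lemma `Config.HasInstance.resolve` and on the unification theorem `exists_mgu_family`). A
computed answer can moreover be renamed at will, since the last most general unifier can be composed
with a permutation of variables (`Reachable.answer_eq_id_or_rename`); hence it suffices to produce
derivations up to variants.

From the extended program to the original one, adornments are erased. A step with an adorned rule
becomes a step with the original rule, and a step with a bridging clause merely adorns the selected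
atom (`Step.erase_or_bridging`). Two bridging steps are never consecutive, so infinite derivations
stay infinite.

From the original program to the extended one, an adorned rule has to be guessed at each resolution
step, and the adornments of its body must be the ones that hold when its atoms are called later on.
They are read off the *future* of the given successful or infinite derivation: a variable is
assigned the integer value that it eventually receives, if any, and `0` otherwise. This assignment
also witnesses that the chosen rule is consistent (`exists_adorned_rule`). The comparisons of the
maximal prefix are true under it because the derivation executes them right after the resolution
step and does not end there, and the adornment of the head is true because, at integer argument
positions, the selected atom holds integers. A derivation that fails in the prefix of a rule
contributes nothing to the semantics and need not be simulated.
-/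

namespace LogicProg

/-! ### Substitution and evaluation of terms -/

namespace Term

variable {F : Type*}

@[simp]
theorem subst_var (t : Term F) : t.subst Term.var = t := by
  induction t with
  | var x => rfl
  | int z => rfl
  | neg a ih => simp [subst, ih]
  | op o a b iha ihb => simp [subst, iha, ihb]
  | fn f k args ih => simp [subst, ih]

theorem subst_subst (σ θ : ℕ → Term F) (t : Term F) :
    (t.subst σ).subst θ = t.subst (fun x => (σ x).subst θ) := by
  induction t with
  | var x => rfl
  | int z => rfl
  | neg a ih => simp [subst, ih]
  | op o a b iha ihb => simp [subst, iha, ihb]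
  | fn f k args ih => simp [subst, ih]

theorem subst_eq_subst_iff {θ η : ℕ → Term F} {t : Term F} :
    t.subst θ = t.subst η ↔ ∀ x ∈ t.vars, θ x = η x := by
  induction t with
  | var x => simp [subst, vars]
  | int z => simp [subst, vars]
  | neg a ih => simp [subst, vars, ih]
  | op o a b iha ihb =>
    simp only [subst, vars, op.injEq, true_and, iha, ihb, Finset.mem_union]
    grind
  | fn f k args ih =>
    simp only [subst, vars, fn.injEq, heq_eq_eq, true_and, funext_iff, ih, Finset.mem_biUnion,
      Finset.mem_univ]
    grind

theorem mem_vars_subst {θ : ℕ → Term F} {t : Term F} {y : ℕ} :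
    y ∈ (t.subst θ).vars ↔ ∃ x ∈ t.vars, y ∈ (θ x).vars := by
  induction t with
  | var x => simp [subst, vars]
  | int z => simp [subst, vars]
  | neg a ih => simp [subst, vars, ih]
  | op o a b iha ihb =>
    simp only [subst, vars, Finset.mem_union, iha, ihb]
    grind
  | fn f k args ih =>
    simp only [subst, vars, Finset.mem_biUnion, Finset.mem_univ, ih]
    grind

theorem eval_subst (ν : ℕ → Option ℤ) (θ : ℕ → Term F) (t : Term F) :
    (t.subst θ).eval ν = t.eval (fun x => (θ x).eval ν) := by
  induction t with
  | var x => rfl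
  | int z => rfl
  | neg a ih => simp [subst, eval, ih]
  | op o a b iha ihb => simp [subst, eval, iha, ihb]
  | fn f k args ih => rfl

theorem eval_mono {ν ν' : ℕ → Option ℤ} (h : ∀ x z, ν x = some z → ν' x = some z)
    {t : Term F} {z : ℤ} (ht : t.eval ν = some z) : t.eval ν' = some z := by
  induction t generalizing z with
  | var x => exact h x z ht
  | int w => exact ht
  | neg a ih =>
    simp only [eval, Option.map_eq_some_iff] at ht ⊢
    obtain ⟨w, hw, rfl⟩ := ht
    exact ⟨w, ih hw, rfl⟩
  | op o a b iha ihb =>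
    simp only [eval, Option.bind_eq_some_iff] at ht ⊢
    obtain ⟨u, hu, v, hv, hz⟩ := ht
    exact ⟨u, iha hu, v, ihb hv, hz⟩
  | fn f k args ih => simp [eval] at ht

theorem value_subst {t : Term F} {z : ℤ} (h : t.value = some z) (θ : ℕ → Term F) :
    (t.subst θ).value = some z := by
  rw [value, eval_subst]
  exact eval_mono (by simp) h

/-- The number of symbols of a term; it drives the occurs check. -/
def size : Term F → ℕ
  | var _ => 1
  | int _ => 1
  | neg a => a.size + 1
  | op _ a b => a.size + b.size + 1
  | fn _ _ args => (∑ i, (args i).size) + 1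

theorem size_le_size_subst {θ : ℕ → Term F} {t : Term F} {x : ℕ} (hx : x ∈ t.vars) :
    (θ x).size ≤ (t.subst θ).size := by
  induction t with
  | var y => simp [vars] at hx; simp [subst, hx]
  | int z => simp [vars] at hx
  | neg a ih => exact (ih hx).trans (Nat.le_succ _)
  | op o a b iha ihb =>
    simp only [vars, Finset.mem_union] at hx
    simp only [subst, size]
    rcases hx with hx | hx
    · have := iha hx; omega
    · have := ihb hx; omega
  | fn f k args ih =>
    simp only [vars, Finset.mem_biUnion, Finset.mem_univ, true_and] at hx
    obtain ⟨i, hi⟩ := hx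
    have h2 := Finset.single_le_sum (f := fun i => ((args i).subst θ).size)
      (fun _ _ => Nat.zero_le _) (Finset.mem_univ i)
    exact ((ih i hi).trans h2).trans (Nat.le_succ _)

/-- The occurs check: no substitution unifies a variable with a compound term in which it
occurs. -/
theorem notMem_vars_of_unify {θ : ℕ → Term F} {t : Term F} {x : ℕ} (hne : t ≠ var x)
    (h : θ x = t.subst θ) : x ∉ t.vars := by
  intro hx
  have hs : (θ x).size = (t.subst θ).size := by rw [h]
  cases t with
  | var y => simp [vars] at hx; exact hne (by rw [hx])
  | int z => simp [vars] at hx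
  | neg a =>
    have := size_le_size_subst (θ := θ) (t := a) hx
    simp only [subst, size] at hs
    omega
  | op o a b =>
    simp only [vars, Finset.mem_union] at hx
    simp only [subst, size] at hs
    rcases hx with hx | hx <;> have := size_le_size_subst (θ := θ) hx <;> omega
  | fn f k args =>
    simp only [vars, Finset.mem_biUnion, Finset.mem_univ, true_and] at hx
    obtain ⟨i, hi⟩ := hx
    have h1 := size_le_size_subst (θ := θ) hi
    have h2 := Finset.single_le_sum (f := fun i => ((args i).subst θ).size)
      (fun _ _ => Nat.zero_le _) (Finset.mem_univ i)
    simp only [subst, size] at hs h2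
    omega

/-- Two distinct unifiable terms have a disagreement pair: a variable and a different term which
every unifier of the two terms also unifies. -/
theorem exists_disagreement {γ : ℕ → Term F} {a b : Term F} (hne : a ≠ b)
    (h : a.subst γ = b.subst γ) :
    ∃ (x : ℕ) (t : Term F), t ≠ var x ∧ x ∈ a.vars ∪ b.vars ∧ t.vars ⊆ a.vars ∪ b.vars ∧
      ∀ η : ℕ → Term F, a.subst η = b.subst η → η x = t.subst η := by
  induction a generalizing b with
  | var x => exact ⟨x, b, fun e => hne e.symm, by simp [vars], by simp, fun η hη => hη⟩
  | int z =>
    cases b with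
    | var y => exact ⟨y, int z, hne, by simp [vars], by simp, fun η hη => hη.symm⟩
    | int w => exact absurd h hne
    | _ => simp [subst] at h
  | neg a ih =>
    cases b with
    | var y => exact ⟨y, neg a, hne, by simp [vars], by simp, fun η hη => hη.symm⟩
    | neg b =>
      simp only [subst, neg.injEq] at h
      obtain ⟨x, t, h1, h2, h3, h4⟩ := ih (fun e => hne (by rw [e])) h
      exact ⟨x, t, h1, h2, h3, fun η hη => h4 η (by simpa [subst] using hη)⟩
    | _ => simp [subst] at h
  | op o a a' ih ih' =>
    cases b with
    | var y => exact ⟨y, op o a a', hne, by simp [vars], by simp, fun η hη => hη.symm⟩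
    | op o' b b' =>
      simp only [subst, op.injEq] at h
      obtain ⟨rfl, h, h'⟩ := h
      by_cases hab : a = b
      · obtain ⟨x, t, h1, h2, h3, h4⟩ := ih' (b := b') (fun e => hne (by rw [hab, e])) h'
        refine ⟨x, t, h1, ?_, h3.trans ?_, fun η hη => h4 η (by simp_all [subst])⟩
        · simp only [vars, Finset.mem_union] at h2 ⊢
          tauto
        · intro y
          simp only [vars, Finset.mem_union]
          tauto
      · obtain ⟨x, t, h1, h2, h3, h4⟩ := ih hab h
        refine ⟨x, t, h1, ?_, h3.trans ?_, fun η hη => h4 η (by simp_all [subst])⟩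
        · simp only [vars, Finset.mem_union] at h2 ⊢
          tauto
        · intro y
          simp only [vars, Finset.mem_union]
          tauto
    | _ => simp [subst] at h
  | fn f k args ih =>
    cases b with
    | var y => exact ⟨y, fn f k args, hne, by simp [vars], by simp, fun η hη => hη.symm⟩
    | fn f' k' args' =>
      simp only [subst, fn.injEq] at h
      obtain ⟨rfl, rfl, h⟩ := h
      rw [heq_eq_eq, funext_iff] at h
      obtain ⟨i, hi⟩ : ∃ i, args i ≠ args' i := by
        by_contra! hc
        exact hne (by rw [funext hc])
      obtain ⟨x, t, h1, h2, h3, h4⟩ := ih i hi (h i)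
      have hsub : (args i).vars ∪ (args' i).vars ⊆ (fn f k args).vars ∪ (fn f k args').vars := by
        intro y
        simp only [vars, Finset.mem_union, Finset.mem_biUnion, Finset.mem_univ, true_and]
        rintro (hy | hy)
        · exact Or.inl ⟨i, hy⟩
        · exact Or.inr ⟨i, hy⟩
      refine ⟨x, t, h1, hsub h2, h3.trans hsub, fun η hη => h4 η ?_⟩
      simp only [subst, fn.injEq, heq_eq_eq, true_and, funext_iff] at hη
      exact hη i
    | _ => simp [subst] at h

end Term

/-! ### Existence of most general unifiers -/

namespace Subst

variable {F : Type*}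

theorem id_comp (σ : Subst F) : id.comp σ = σ := rfl

theorem comp_assoc (σ θ η : Subst F) : (σ.comp θ).comp η = σ.comp (θ.comp η) := by
  ext x
  exact Term.subst_subst _ _ _

theorem subst_comp (σ θ : Subst F) (t : Term F) :
    t.subst (σ.comp θ).toFun = (t.subst σ.toFun).subst θ.toFun :=
  (Term.subst_subst _ _ _).symm

/-- The substitution that replaces the single variable `x` by `t`. -/
def single (x : ℕ) (t : Term F) : Subst F where
  toFun := Function.update Term.var x t
  finite_support := (Set.finite_singleton x).subset fun y hy => by
    by_contra hne
    exact hy (Function.update_of_ne hne _ _)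

theorem single_comp {x : ℕ} {t : Term F} {γ : Subst F} (h : γ.toFun x = t.subst γ.toFun) :
    (single x t).comp γ = γ := by
  ext y
  change (Function.update Term.var x t y).subst γ.toFun = γ.toFun y
  by_cases hy : y = x
  · subst hy
    rw [Function.update_self, h]
  · rw [Function.update_of_ne hy]
    rfl

theorem vars_subst_single {x : ℕ} {t s : Term F} {V : Finset ℕ} (hs : s.vars ⊆ V)
    (ht : t.vars ⊆ V) (hx : x ∉ t.vars) : (s.subst (single x t).toFun).vars ⊆ V.erase x := by
  intro y hy
  obtain ⟨w, hw, hy⟩ := Term.mem_vars_subst.1 hy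
  change y ∈ (Function.update Term.var x t w).vars at hy
  rw [Finset.mem_erase]
  by_cases hwx : w = x
  · subst hwx
    rw [Function.update_self] at hy
    exact ⟨fun e => hx (e ▸ hy), ht hy⟩
  · rw [Function.update_of_ne hwx] at hy
    simp only [Term.vars, Finset.mem_singleton] at hy
    subst hy
    exact ⟨hwx, hs hw⟩

end Subst

/-- The unification theorem for finite systems of equations. Among the substitutions through which
every unifier factors, one that leaves the fewest variables in the system is a unifier: a
disagreement pair would allow a further variable to be eliminated. -/
theorem exists_mgu_family {F ι : Type*} [Finite ι] (a b : ι → Term F)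
    (h : ∃ η : Subst F, ∀ i, (a i).subst η.toFun = (b i).subst η.toFun) :
    ∃ θ : Subst F, (∀ i, (a i).subst θ.toFun = (b i).subst θ.toFun) ∧
      ∀ η : Subst F, (∀ i, (a i).subst η.toFun = (b i).subst η.toFun) →
        ∃ γ : Subst F, η = θ.comp γ := by
  obtain ⟨η₀, hη₀⟩ := h
  have key : ∀ (n : ℕ) (θ : Subst F) (V : Finset ℕ), V.card = n →
      (∀ i, ((a i).subst θ.toFun).vars ⊆ V ∧ ((b i).subst θ.toFun).vars ⊆ V) →
      (∀ η : Subst F, (∀ i, (a i).subst η.toFun = (b i).subst η.toFun) →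
        ∃ γ : Subst F, η = θ.comp γ) →
      ∃ θ : Subst F, (∀ i, (a i).subst θ.toFun = (b i).subst θ.toFun) ∧
        ∀ η : Subst F, (∀ i, (a i).subst η.toFun = (b i).subst η.toFun) →
          ∃ γ : Subst F, η = θ.comp γ := by
    intro n
    induction n using Nat.strong_induction_on with
    | _ n ih =>
      intro θ V hV hvars hθ
      by_cases hu : ∀ i, (a i).subst θ.toFun = (b i).subst θ.toFun
      · exact ⟨θ, hu, hθ⟩
      · push Not at hu
        obtain ⟨i, hi⟩ := hu
        obtain ⟨γ₀, hγ₀⟩ := hθ η₀ hη₀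
        have hγi := hη₀ i
        rw [hγ₀, Subst.subst_comp, Subst.subst_comp] at hγi
        obtain ⟨x, t, hne, hx, ht, hall⟩ := Term.exists_disagreement hi hγi
        have hocc : x ∉ t.vars := Term.notMem_vars_of_unify hne (hall _ hγi)
        have hsub := Finset.union_subset (hvars i).1 (hvars i).2
        refine ih _ ?_ (θ.comp (Subst.single x t)) (V.erase x) rfl ?_ ?_
        · rw [← hV]
          exact Finset.card_erase_lt_of_mem (hsub hx)
        · intro j
          rw [Subst.subst_comp, Subst.subst_comp]
          exact ⟨Subst.vars_subst_single (hvars j).1 (ht.trans hsub) hocc,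
            Subst.vars_subst_single (hvars j).2 (ht.trans hsub) hocc⟩
        · intro η hη
          obtain ⟨γ, rfl⟩ := hθ η hη
          refine ⟨γ, ?_⟩
          have := hη i
          rw [Subst.subst_comp, Subst.subst_comp] at this
          rw [Subst.comp_assoc, Subst.single_comp (hall _ this)]
  classical
  have := Fintype.ofFinite ι
  refine key _ Subst.id
    (Finset.univ.biUnion fun i =>
      ((a i).subst Subst.id.toFun).vars ∪ ((b i).subst Subst.id.toFun).vars) rfl
    (fun i => ⟨fun y hy => ?_, fun y hy => ?_⟩) fun η _ => ⟨η, (Subst.id_comp η).symm⟩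
  · exact Finset.mem_biUnion.2 ⟨i, Finset.mem_univ _, Finset.mem_union_left _ hy⟩
  · exact Finset.mem_biUnion.2 ⟨i, Finset.mem_univ _, Finset.mem_union_right _ hy⟩

section

variable {F : Type*} {Pr : Type*} {ar : Pr → ℕ}

theorem Term.exists_mgu {a b : Term F}
    (h : ∃ η : Subst F, a.subst η.toFun = b.subst η.toFun) :
    ∃ θ : Subst F, IsMGU Term.subst θ a b := by
  obtain ⟨η, hη⟩ := h
  obtain ⟨θ, h1, h2⟩ := exists_mgu_family (fun _ : Unit => a) (fun _ => b) ⟨η, fun _ => hη⟩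
  exact ⟨θ, h1 (), fun η hη => h2 η fun _ => hη⟩

theorem Atom.exists_mgu {A B : Atom F ar}
    (h : ∃ η : Subst F, A.subst η.toFun = B.subst η.toFun) :
    ∃ θ : Subst F, IsMGU Atom.subst θ A B := by
  obtain ⟨η, hη⟩ := h
  obtain ⟨q, a⟩ := A
  obtain ⟨q', b⟩ := B
  obtain rfl : q = q' := congrArg Atom.rel hη
  have hiff : ∀ η : Subst F, Atom.subst η.toFun (⟨q, a⟩ : Atom F ar) = Atom.subst η.toFun ⟨q, b⟩ ↔
      ∀ i, (a i).subst η.toFun = (b i).subst η.toFun := by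
    intro η
    simp only [Atom.subst, Atom.mk.injEq, heq_eq_eq, true_and, funext_iff]
  obtain ⟨θ, h1, h2⟩ := exists_mgu_family a b ⟨η, (hiff η).1 hη⟩
  exact ⟨θ, (hiff θ).2 h1, fun η hη => h2 η ((hiff η).1 hη)⟩

end

/-! ### Substitution in atoms, literals and clauses -/

section

variable {F : Type*} {Pr : Type*} {ar : Pr → ℕ}

theorem Atom.subst_subst (σ θ : ℕ → Term F) (A : Atom F ar) :
    (A.subst σ).subst θ = A.subst (fun x => (σ x).subst θ) := by
  simp [Atom.subst, Term.subst_subst]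

theorem Atom.subst_congr {θ η : ℕ → Term F} {A : Atom F ar} (h : ∀ x ∈ A.vars, θ x = η x) :
    A.subst θ = A.subst η := by
  obtain ⟨q, args⟩ := A
  simp only [Atom.subst, Atom.mk.injEq, heq_eq_eq, true_and]
  funext i
  exact Term.subst_eq_subst_iff.2 fun x hx =>
    h x (Finset.mem_biUnion.2 ⟨i, Finset.mem_univ _, hx⟩)

theorem Literal.subst_subst (σ θ : ℕ → Term F) (L : Literal F ar) :
    (L.subst σ).subst θ = L.subst (fun x => (σ x).subst θ) := by
  cases L <;> simp [Literal.subst, Term.subst_subst, Atom.subst_subst]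

theorem Literal.subst_congr {θ η : ℕ → Term F} {L : Literal F ar}
    (h : ∀ x ∈ L.vars, θ x = η x) : L.subst θ = L.subst η := by
  cases L with
  | atom A => exact congrArg Literal.atom (Atom.subst_congr h)
  | cmp c a b =>
    simp only [Literal.vars, Finset.mem_union] at h
    simp only [Literal.subst, Literal.cmp.injEq, true_and]
    exact ⟨Term.subst_eq_subst_iff.2 fun x hx => h x (Or.inl hx),
      Term.subst_eq_subst_iff.2 fun x hx => h x (Or.inr hx)⟩
  | assign a b =>
    simp only [Literal.vars, Finset.mem_union] at h
    simp only [Literal.subst, Literal.assign.injEq]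
    exact ⟨Term.subst_eq_subst_iff.2 fun x hx => h x (Or.inl hx),
      Term.subst_eq_subst_iff.2 fun x hx => h x (Or.inr hx)⟩

theorem Atom.mem_vars_subst {θ : ℕ → Term F} {A : Atom F ar} {y : ℕ} :
    y ∈ (A.subst θ).vars ↔ ∃ x ∈ A.vars, y ∈ (θ x).vars := by
  simp only [Atom.vars, Atom.subst, Finset.mem_biUnion, Finset.mem_univ, true_and,
    Term.mem_vars_subst]
  grind

theorem Literal.mem_vars_subst {θ : ℕ → Term F} {L : Literal F ar} {y : ℕ} :
    y ∈ (L.subst θ).vars ↔ ∃ x ∈ L.vars, y ∈ (θ x).vars := by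
  cases L with
  | atom A => exact Atom.mem_vars_subst
  | cmp c a b =>
    simp only [Literal.vars, Literal.subst, Finset.mem_union, Term.mem_vars_subst]
    grind
  | assign a b =>
    simp only [Literal.vars, Literal.subst, Finset.mem_union, Term.mem_vars_subst]
    grind

@[simp]
theorem Atom.subst_var (A : Atom F ar) : A.subst Term.var = A := by
  simp [Atom.subst]

@[simp]
theorem Literal.subst_var (L : Literal F ar) : L.subst Term.var = L := by
  cases L <;> simp [Literal.subst]

/-- Application of a substitution to a query. -/
def Query.subst (θ : ℕ → Term F) (G : Query F ar) : Query F ar := G.map (Literal.subst θ)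

theorem Query.mem_vars {G : Query F ar} {y : ℕ} : y ∈ Query.vars G ↔ ∃ L ∈ G, y ∈ L.vars := by
  unfold Query.vars
  induction G with
  | nil => simp
  | cons L G ih => simp [ih]

theorem Query.subst_subst (σ θ : ℕ → Term F) (G : Query F ar) :
    Query.subst θ (Query.subst σ G) = Query.subst (fun x => (σ x).subst θ) G := by
  simp [Query.subst, Literal.subst_subst]

theorem Query.subst_congr {θ η : ℕ → Term F} {G : Query F ar}
    (h : ∀ x ∈ Query.vars G, θ x = η x) : Query.subst θ G = Query.subst η G :=
  List.map_congr_left fun _ hL => Literal.subst_congr fun x hx =>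
    h x (Query.mem_vars.2 ⟨_, hL, hx⟩)

theorem Query.mem_vars_subst {θ : ℕ → Term F} {G : Query F ar} {y : ℕ} :
    y ∈ Query.vars (Query.subst θ G) ↔ ∃ x ∈ Query.vars G, y ∈ (θ x).vars := by
  simp only [Query.mem_vars, Query.subst, List.mem_map, exists_exists_and_eq_and,
    Literal.mem_vars_subst]
  grind

@[simp]
theorem Query.subst_var (G : Query F ar) : Query.subst Term.var G = G := by
  rw [Query.subst, funext Literal.subst_var]
  exact List.map_id G

@[simp]
theorem Query.subst_cons (θ : ℕ → Term F) (L : Literal F ar) (G : Query F ar) :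
    Query.subst θ (L :: G) = L.subst θ :: Query.subst θ G := rfl

theorem Query.subst_append (θ : ℕ → Term F) (G H : Query F ar) :
    Query.subst θ (G ++ H) = Query.subst θ G ++ Query.subst θ H :=
  List.map_append

theorem Clause.mem_vars_rename {ρ : Equiv.Perm ℕ} {r : Clause F ar} {y : ℕ} :
    y ∈ (r.rename ρ).vars ↔ ∃ x ∈ r.vars, y = ρ x := by
  have : (r.rename ρ).vars = (r.head.subst fun x => .var (ρ x)).vars ∪
      Query.vars (Query.subst (fun x => .var (ρ x)) r.body) := rfl
  rw [this, Finset.mem_union, Atom.mem_vars_subst, Query.mem_vars_subst]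
  simp only [Clause.vars, Finset.mem_union, Term.vars, Finset.mem_singleton]
  grind

theorem Subst.mem_vars_or {θ : Subst F} {x y : ℕ} (hy : y ∈ (θ.toFun x).vars) :
    y = x ∨ y ∈ θ.vars := by
  by_cases hx : θ.toFun x = .var x
  · rw [hx] at hy
    exact Or.inl (by simpa [Term.vars] using hy)
  · exact Or.inr ⟨x, hx, Or.inr hy⟩

theorem Subst.finite_vars (θ : Subst F) : θ.vars.Finite := by
  refine (θ.finite_support.union
    (θ.finite_support.biUnion fun x _ => (θ.toFun x).vars.finite_toSet)).subset ?_
  rintro y ⟨x, hx, rfl | hy⟩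
  · exact Or.inl hx
  · exact Or.inr (Set.mem_biUnion (x := x) hx hy)

/-- Any clause has a variant that is standardised apart from a given finite set of variables. -/
theorem Clause.exists_fresh_rename (r : Clause F ar) {V : Set ℕ} (hV : V.Finite) :
    ∃ ρ : Equiv.Perm ℕ, Disjoint (↑(r.rename ρ).vars : Set ℕ) V := by
  obtain ⟨N, hN⟩ := (hV.union r.vars.finite_toSet).bddAbove
  -- The permutation that exchanges the blocks `[0, N]` and `[N + 1, 2 * N + 1]`.
  let f : ℕ → ℕ := fun x => if x ≤ N then x + (N + 1) else if x ≤ 2 * N + 1 then x - (N + 1) else x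
  have hf : Function.Involutive f := by
    intro x
    simp only [f]
    split_ifs <;> omega
  refine ⟨hf.toPerm, Set.disjoint_left.2 fun y hy hyV => ?_⟩
  obtain ⟨x, hx, rfl⟩ := Clause.mem_vars_rename.1 hy
  have h1 : x ≤ N := hN (Or.inr hx)
  have h2 : f x ≤ N := hN (Or.inl hyV)
  simp only [f, h1, if_true] at h2
  omega

/-- For a clause that is standardised apart, a substitution of its own variables and a
substitution of the variables used before can be merged into one. -/
theorem Clause.exists_merge {r : Clause F ar} {ρ : Equiv.Perm ℕ} {V : Set ℕ}
    (hfresh : Disjoint (↑(r.rename ρ).vars : Set ℕ) V) (η : Subst F) (f : ℕ → Term F) :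
    ∃ ζ : Subst F, (∀ x ∈ V, ζ.toFun x = η.toFun x) ∧
      (r.rename ρ).head.subst ζ.toFun = r.head.subst f ∧
      Query.subst ζ.toFun (r.rename ρ).body = Query.subst f r.body := by
  let ζ : Subst F :=
    { toFun := fun x => if x ∈ (r.rename ρ).vars then f (ρ.symm x) else η.toFun x
      finite_support := ((r.rename ρ).vars.finite_toSet.union η.finite_support).subset fun x hx => by
        by_cases h : x ∈ (r.rename ρ).vars
        · exact Or.inl h
        · right
          simpa [h] using hx }
  have hρ : ∀ x ∈ r.vars, ζ.toFun (ρ x) = f x := by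
    intro x hx
    simp [ζ, Clause.mem_vars_rename.2 ⟨x, hx, rfl⟩]
  refine ⟨ζ, fun x hx => if_neg fun h => Set.disjoint_left.1 hfresh h hx, ?_, ?_⟩
  · change (r.head.subst _).subst _ = _
    rw [Atom.subst_subst]
    exact Atom.subst_congr fun x hx => hρ x (Finset.mem_union_left _ hx)
  · change Query.subst _ (Query.subst _ r.body) = _
    rw [Query.subst_subst]
    exact Query.subst_congr fun x hx => hρ x (Finset.mem_union_right _ hx)

/-! ### Variants of configurations -/

/-- `C'` is an instance of `C`, as far as the goal and the values of the variables in `V₀` are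
concerned. The sets of used variables are not compared. -/
def Config.HasInstance (V₀ : Finset ℕ) (C C' : Config F ar) : Prop :=
  ∃ η : Subst F, (∀ x ∈ V₀, C'.answer.toFun x = (C.answer.toFun x).subst η.toFun) ∧
    C'.goal = Query.subst η.toFun C.goal

/-- Two configurations are variants if each is an instance of the other. -/
def Config.Variant (V₀ : Finset ℕ) (C C' : Config F ar) : Prop :=
  C.HasInstance V₀ C' ∧ C'.HasInstance V₀ C

theorem Config.HasInstance.trans {V₀ : Finset ℕ} {C D E : Config F ar}
    (h : C.HasInstance V₀ D) (h' : D.HasInstance V₀ E) : C.HasInstance V₀ E := by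
  obtain ⟨η, h1, h2⟩ := h
  obtain ⟨η', h1', h2'⟩ := h'
  refine ⟨η.comp η', fun x hx => ?_, ?_⟩
  · rw [h1' x hx, h1 x hx, Subst.subst_comp]
  · rw [h2', h2, Query.subst_subst]
    rfl

theorem Config.HasInstance.of_eq {V₀ : Finset ℕ} {C D : Config F ar} (h : D.goal = C.goal)
    (h' : D.answer = C.answer) : C.HasInstance V₀ D :=
  ⟨Subst.id, fun x _ => by rw [h']; exact (Term.subst_var _).symm,
    by rw [h]; exact (Query.subst_var _).symm⟩

theorem Config.Variant.refl (V₀ : Finset ℕ) (C : Config F ar) : C.Variant V₀ C :=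
  ⟨.of_eq rfl rfl, .of_eq rfl rfl⟩

theorem Config.Variant.symm {V₀ : Finset ℕ} {C D : Config F ar} (h : C.Variant V₀ D) :
    D.Variant V₀ C := ⟨h.2, h.1⟩

theorem Config.Variant.trans {V₀ : Finset ℕ} {C D E : Config F ar}
    (h : C.Variant V₀ D) (h' : D.Variant V₀ E) : C.Variant V₀ E :=
  ⟨h.1.trans h'.1, h'.2.trans h.2⟩

/-- The used variables are finitely many and comprise those of the goal and those in the values
of the variables in `V₀`. -/
structure Config.WF (V₀ : Finset ℕ) (C : Config F ar) : Prop where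
  finite : C.used.Finite
  goal : ∀ x ∈ Query.vars C.goal, x ∈ C.used
  answer : ∀ x ∈ V₀, ∀ y ∈ (C.answer.toFun x).vars, y ∈ C.used

theorem Config.WF.init (Q : Query F ar) : (Config.init Q).WF (Query.vars Q) where
  finite := (Query.vars Q).finite_toSet
  goal := fun x hx => hx
  answer := fun x hx y hy => by
    simp only [Config.init, Subst.id, Term.vars, Finset.mem_singleton] at hy ⊢
    rwa [hy]

theorem Step.wf {P : Program F ar} {V₀ : Finset ℕ} {C D : Config F ar} (h : Step P C D)
    (hC : C.WF V₀) : D.WF V₀ := by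
  obtain ⟨hfin, hgoal, hans⟩ := hC
  cases h with
  | resolve A G V σ θ r ρ hr hfresh hθ =>
    refine ⟨(hfin.union (r.rename ρ).vars.finite_toSet).union θ.finite_vars, ?_, ?_⟩
    · intro y hy
      obtain ⟨x, hx, hxy⟩ := Query.mem_vars_subst.1 hy
      rcases Subst.mem_vars_or hxy with rfl | h
      · left
        obtain ⟨L, hL, hyL⟩ := Query.mem_vars.1 hx
        rcases List.mem_append.1 hL with hL | hL
        · exact Or.inr (Finset.mem_union_right _ (Query.mem_vars.2 ⟨L, hL, hyL⟩))
        · exact Or.inl (hgoal _ (Query.mem_vars.2 ⟨L, List.mem_cons_of_mem _ hL, hyL⟩))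
      · exact Or.inr h
    · intro x hx y hy
      obtain ⟨w, hw, hwy⟩ := Term.mem_vars_subst.1 hy
      rcases Subst.mem_vars_or hwy with rfl | h
      · exact Or.inl (Or.inl (hans x hx _ hw))
      · exact Or.inr h
  | cmp c a b x y G V σ ha hb hc =>
    refine ⟨hfin, fun x hx => hgoal x ?_, hans⟩
    obtain ⟨L, hL, hxL⟩ := Query.mem_vars.1 hx
    exact Query.mem_vars.2 ⟨L, List.mem_cons_of_mem _ hL, hxL⟩
  | assign t e z G V σ θ he hθ =>
    refine ⟨hfin.union θ.finite_vars, ?_, ?_⟩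
    · intro y hy
      obtain ⟨x, hx, hxy⟩ := Query.mem_vars_subst.1 hy
      rcases Subst.mem_vars_or hxy with rfl | h
      · left
        obtain ⟨L, hL, hyL⟩ := Query.mem_vars.1 hx
        exact hgoal _ (Query.mem_vars.2 ⟨L, List.mem_cons_of_mem _ hL, hyL⟩)
      · exact Or.inr h
    · intro x hx y hy
      obtain ⟨w, hw, hwy⟩ := Term.mem_vars_subst.1 hy
      rcases Subst.mem_vars_or hwy with rfl | h
      · exact Or.inl (hans x hx _ hw)
      · exact Or.inr h

theorem Reachable.wf {P : Program F ar} {Q : Query F ar} {C : Config F ar}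
    (h : Reachable P Q C) : C.WF (Query.vars Q) := by
  induction h with
  | refl => exact Config.WF.init Q
  | tail _ hs ih => exact hs.wf ih

/-- The lifting lemma: a unifier of an instance of the selected atom with a variant of a clause
yields an instance of every resolvent with that clause. -/
theorem Config.HasInstance.resolve {V₀ : Finset ℕ} {A A' : Atom F ar} {G G' : Query F ar}
    {V V' V'' : Set ℕ} {σ σ' θ θ' : Subst F} {r : Clause F ar} {ρ ρ' : Equiv.Perm ℕ}
    (h : Config.HasInstance V₀ ⟨.atom A :: G, V, σ⟩ ⟨.atom A' :: G', V', σ'⟩)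
    (hC : Config.WF V₀ ⟨.atom A :: G, V, σ⟩)
    (hfresh : Disjoint (↑(r.rename ρ).vars : Set ℕ) V)
    (hθ : IsMGU Atom.subst θ A (r.rename ρ).head)
    (hθ' : A'.subst θ'.toFun = (r.rename ρ').head.subst θ'.toFun) {W : Set ℕ} :
    Config.HasInstance V₀ ⟨((r.rename ρ).body ++ G).map (Literal.subst θ.toFun), V'', σ.comp θ⟩
      ⟨((r.rename ρ').body ++ G').map (Literal.subst θ'.toFun), W, σ'.comp θ'⟩ := by
  obtain ⟨η, h1, h2⟩ := h
  simp only [Query.subst_cons, List.cons.injEq, Literal.subst, Literal.atom.injEq] at h1 h2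
  obtain ⟨rfl, rfl⟩ := h2
  -- `ζ` maps the variant by `ρ` to that by `ρ'` instantiated by `θ'`, and old variables to their
  -- values in the given resolvent; it unifies, hence factors through `θ`.
  obtain ⟨ζ, hζ, hhead, hbody⟩ := Clause.exists_merge hfresh (η.comp θ')
    (fun x => (Term.var (ρ' x)).subst θ'.toFun)
  have hA : ∀ x ∈ A.vars, x ∈ V := fun x hx =>
    hC.goal x (Query.mem_vars.2 ⟨_, List.mem_cons_self, hx⟩)
  have hG : ∀ x ∈ Query.vars G, x ∈ V := fun x hx => by
    obtain ⟨L, hL, hxL⟩ := Query.mem_vars.1 hx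
    exact hC.goal x (Query.mem_vars.2 ⟨L, List.mem_cons_of_mem _ hL, hxL⟩)
  obtain ⟨γ, rfl⟩ := hθ.2 ζ (by
    rw [Atom.subst_congr fun x hx => hζ x (hA x hx), hhead]
    refine Eq.trans ?_ (hθ'.trans (Atom.subst_subst _ _ _))
    exact (Atom.subst_subst _ _ _).symm)
  refine ⟨γ, fun x hx => ?_, ?_⟩
  · change (σ'.toFun x).subst θ'.toFun = ((σ.toFun x).subst θ.toFun).subst γ.toFun
    rw [h1 x hx, ← Subst.subst_comp, ← Subst.subst_comp]
    exact (Term.subst_eq_subst_iff.2 fun y hy => hζ y (hC.answer x hx y hy)).symm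
  · change Query.subst _ _ = Query.subst _ (Query.subst _ _)
    rw [Query.subst_append, Query.subst_append, Query.subst_append]
    refine congrArg₂ _ (Eq.trans ?_ (hbody.symm.trans (Query.subst_subst _ _ _).symm)) ?_
    · exact Query.subst_subst _ _ _
    · rw [Query.subst_subst, Query.subst_subst]
      exact (Query.subst_congr fun x hx => hζ x (hG x hx)).symm

/-- The lifting lemma for assignments. -/
theorem Config.HasInstance.assign {V₀ : Finset ℕ} {t e t' e' : Term F} {G G' : Query F ar}
    {V V' V'' : Set ℕ} {σ σ' θ θ' : Subst F} {z : ℤ}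
    (h : Config.HasInstance V₀ ⟨.assign t e :: G, V, σ⟩ ⟨.assign t' e' :: G', V', σ'⟩)
    (hθ : IsMGU Term.subst θ t (.int z))
    (hθ' : t'.subst θ'.toFun = Term.subst θ'.toFun (.int z)) {W : Set ℕ} :
    Config.HasInstance V₀ ⟨G.map (Literal.subst θ.toFun), V'', σ.comp θ⟩
      ⟨G'.map (Literal.subst θ'.toFun), W, σ'.comp θ'⟩ := by
  obtain ⟨η, h1, h2⟩ := h
  simp only [Query.subst_cons, List.cons.injEq, Literal.subst, Literal.assign.injEq] at h1 h2
  obtain ⟨⟨rfl, rfl⟩, rfl⟩ := h2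
  obtain ⟨γ, hγ⟩ := hθ.2 (η.comp θ') (by rw [Subst.subst_comp, hθ']; rfl)
  refine ⟨γ, fun x hx => ?_, ?_⟩
  · change (σ'.toFun x).subst θ'.toFun = ((σ.toFun x).subst θ.toFun).subst γ.toFun
    rw [h1 x hx, ← Subst.subst_comp, ← Subst.subst_comp, hγ]
  · change Query.subst _ _ = Query.subst _ (Query.subst _ _)
    rw [Query.subst_subst, Query.subst_subst]
    change Query.subst (η.comp θ').toFun G = Query.subst (θ.comp γ).toFun G
    rw [hγ]

/-- The variant lemma: being variants is a bisimulation for LD-derivation steps. -/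
theorem Step.exists_variant {P : Program F ar} {V₀ : Finset ℕ} {C C' D' : Config F ar}
    (hv : C.Variant V₀ C') (hC : C.WF V₀) (hC' : C'.WF V₀) (h : Step P C' D') :
    ∃ D, Step P C D ∧ D.Variant V₀ D' := by
  obtain ⟨h1, h2⟩ := hv
  obtain ⟨G₀, V, σ⟩ := C
  have h1' := h1
  have h2' := h2
  obtain ⟨η, -, hη⟩ := h1'
  obtain ⟨η', -, hη'⟩ := h2'
  simp only at hη hη'
  cases h with
  | resolve A' G' V' σ' θ' r ρ' hr hfresh' hθ' =>
    rcases G₀ with _ | ⟨_ | _ | _, G⟩ <;> simp [Query.subst, Literal.subst] at hη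
    rename_i A
    obtain ⟨ρ, hfresh⟩ := r.exists_fresh_rename hC.finite
    obtain ⟨ζ, hζ, hhead, -⟩ := Clause.exists_merge hfresh (η.comp θ')
      (fun x => (Term.var (ρ' x)).subst θ'.toFun)
    have hA : ∀ x ∈ A.vars, x ∈ V := fun x hx =>
      hC.goal x (Query.mem_vars.2 ⟨_, List.mem_cons_self, hx⟩)
    obtain ⟨θ, hθ⟩ := Atom.exists_mgu (A := A) (B := (r.rename ρ).head) ⟨ζ, by
      rw [Atom.subst_congr fun x hx => hζ x (hA x hx), hhead]
      refine Eq.trans ?_ (hθ'.1.trans (Atom.subst_subst _ _ _))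
      rw [hη.1]
      exact (Atom.subst_subst _ _ _).symm⟩
    exact ⟨_, .resolve A G V σ θ r ρ hr hfresh hθ, h1.resolve hC hfresh hθ hθ'.1,
      h2.resolve hC' hfresh' hθ' hθ.1⟩
  | cmp c a' b' x y G' V' σ' ha hb hc =>
    -- The terms `a'`, `b'` have values, so their instances `a`, `b` have the same ones.
    rcases G₀ with _ | ⟨_ | ⟨c', a, b⟩ | _, G⟩ <;> simp [Query.subst, Literal.subst] at hη
    obtain ⟨⟨rfl, rfl, rfl⟩, rfl⟩ := hη
    simp only [Query.subst, List.map_cons, Literal.subst, List.cons.injEq, Literal.cmp.injEq,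
      true_and] at hη'
    refine ⟨_, .cmp c a b x y G V σ ?_ ?_ hc, ?_, ?_⟩
    · rw [hη'.1.1]
      exact Term.value_subst ha _
    · rw [hη'.1.2]
      exact Term.value_subst hb _
    · obtain ⟨η, hη, hG⟩ := h1
      exact ⟨η, hη, (List.cons.inj hG).2⟩
    · obtain ⟨η, hη, hG⟩ := h2
      exact ⟨η, hη, (List.cons.inj hG).2⟩
  | assign t' e' z G' V' σ' θ' he hθ' =>
    rcases G₀ with _ | ⟨_ | _ | ⟨t, e⟩, G⟩ <;> simp [Query.subst, Literal.subst] at hη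
    obtain ⟨⟨rfl, rfl⟩, rfl⟩ := hη
    simp only [Query.subst, List.map_cons, Literal.subst, List.cons.injEq,
      Literal.assign.injEq] at hη'
    have he' : e.value = some z := by
      rw [hη'.1.2]
      exact Term.value_subst he _
    obtain ⟨θ, hθ⟩ := Term.exists_mgu (a := t) (b := .int z) ⟨η.comp θ', by
      rw [Subst.subst_comp, hθ'.1]; rfl⟩
    exact ⟨_, .assign t e z G V σ θ he' hθ, h1.assign hθ hθ'.1, h2.assign hθ' hθ.1⟩

/-! ### Renaming of computed answers -/

/-- A finite injective renaming of variables extends to an invertible substitution. -/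
theorem exists_renaming {W : Finset ℕ} {f : ℕ → ℕ} (hf : Set.InjOn f W) :
    ∃ π π' : Subst F, π.comp π' = Subst.id ∧ ∀ x ∈ W, π.toFun x = .var (f x) := by
  classical
  let U : Finset ℕ := W ∪ W.image f
  obtain ⟨g, hg⟩ := Finset.exists_equiv_extend_of_card_eq (α := U) (t := U)
    (s := Finset.univ.filter fun x : U => (x : ℕ) ∈ W) (f := fun x => f x) (by simp)
    (by
      intro y hy
      obtain ⟨x, hx, rfl⟩ := Finset.mem_image.1 hy
      exact Finset.mem_union_right _ (Finset.mem_image_of_mem _ (Finset.mem_filter.1 hx).2))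
    (by
      intro x hx y hy hxy
      exact Subtype.ext (hf (Finset.mem_filter.1 hx).2 (Finset.mem_filter.1 hy).2 hxy))
  have hsupp : ∀ e : Equiv.Perm U,
      {x | (Term.var (Equiv.Perm.ofSubtype e x) : Term F) ≠ .var x}.Finite := fun e =>
    U.finite_toSet.subset fun x hx => by
      by_contra hxU
      exact hx (by rw [Equiv.Perm.ofSubtype_apply_of_not_mem e hxU])
  refine ⟨⟨_, hsupp g⟩, ⟨_, hsupp g⁻¹⟩, ?_, fun x hx => ?_⟩
  · ext x
    simp [Subst.comp, Subst.id, Term.subst]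
  · have hxU : x ∈ U := Finset.mem_union_left _ hx
    have := hg ⟨x, hxU⟩ (by simpa using hx)
    change Term.var (Equiv.Perm.ofSubtype g x) = _
    rw [Equiv.Perm.ofSubtype_apply_of_mem g hxU, this]

/-- Variants differ, on the values of the variables in `V₀`, by an invertible substitution. -/
theorem Config.Variant.exists_renaming {V₀ : Finset ℕ} {C C' : Config F ar}
    (h : C.Variant V₀ C') : ∃ π π' : Subst F, π.comp π' = Subst.id ∧
      ∀ x ∈ V₀, C'.answer.toFun x = (C.answer.toFun x).subst π.toFun := by
  classical
  obtain ⟨⟨η, hη, -⟩, ⟨η', hη', -⟩⟩ := h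
  -- On the variables in `W` the instantiations `η` and `η'` are inverse to each other, so that `η`
  -- maps them injectively to variables.
  let W := V₀.biUnion fun x => (C.answer.toFun x).vars
  have hW : ∀ y ∈ W, (η.toFun y).subst η'.toFun = .var y := by
    intro y hy
    obtain ⟨x, hx, hy⟩ := Finset.mem_biUnion.1 hy
    have := hη' x hx
    rw [hη x hx, Term.subst_subst] at this
    nth_rw 1 [← Term.subst_var (C.answer.toFun x)] at this
    exact (Term.subst_eq_subst_iff.1 this y hy).symm
  have hvar : ∀ y ∈ W, ∃ w, η.toFun y = .var w := by
    intro y hy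
    have := hW y hy
    cases hηy : η.toFun y with
    | var w => exact ⟨w, rfl⟩
    | _ => rw [hηy] at this; simp [Term.subst] at this
  choose! f hf using hvar
  obtain ⟨π, π', h1, h2⟩ := LogicProg.exists_renaming (F := F) (W := W) (f := f) (by
    intro x hx y hy hxy
    have h1 := hW x hx
    have h2 := hW y hy
    rw [hf x hx, hxy, ← hf y hy, h2] at h1
    exact (Term.var.inj h1).symm)
  refine ⟨π, π', h1, fun x hx => ?_⟩
  rw [hη x hx]
  refine Term.subst_eq_subst_iff.2 fun y hy => ?_
  have hyW : y ∈ W := Finset.mem_biUnion.2 ⟨x, hx, hy⟩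
  rw [hf y hyW, h2 y hyW]

theorem IsMGU.comp_renaming {α : Type*} {act : (ℕ → Term F) → α → α} {θ π π' : Subst F} {a b : α}
    (hact : ∀ (σ θ : Subst F) (a : α), act (σ.comp θ).toFun a = act θ.toFun (act σ.toFun a))
    (h : IsMGU act θ a b) (hπ : π.comp π' = Subst.id) : IsMGU act (θ.comp π) a b := by
  refine ⟨by rw [hact, hact, h.1], fun η hη => ?_⟩
  obtain ⟨γ, rfl⟩ := h.2 η hη
  refine ⟨π'.comp γ, ?_⟩
  rw [Subst.comp_assoc, ← Subst.comp_assoc π, hπ, Subst.id_comp]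

/-- Is the literal an arithmetic comparison? -/
def Literal.IsCmp (L : Literal F ar) : Prop := ∃ c a b, L = .cmp c a b

/-- A derivation either has performed comparisons only, or else its answer can be renamed at
will, since the last unifier can be composed with an invertible substitution. -/
theorem Reachable.answer_eq_id_or_rename {P : Program F ar} {Q : Query F ar} {C : Config F ar}
    (h : Reachable P Q C) :
    (C.answer = Subst.id ∧ ∃ pre, Q = pre ++ C.goal ∧ ∀ L ∈ pre, L.IsCmp) ∨
    ∀ π π' : Subst F, π.comp π' = Subst.id → ∃ C', Reachable P Q C' ∧
      C'.goal = Query.subst π.toFun C.goal ∧ C'.answer = C.answer.comp π := by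
  induction h with
  | refl => exact Or.inl ⟨rfl, [], rfl, by simp⟩
  | tail hr hs ih =>
    cases hs with
    | resolve A G V σ θ r ρ hrP hfresh hθ =>
      refine Or.inr fun π π' hπ => ⟨_, hr.tail (.resolve A G V σ (θ.comp π) r ρ hrP hfresh
        (hθ.comp_renaming (fun σ θ a => (Atom.subst_subst _ _ _).symm) hπ)), ?_, ?_⟩
      · exact (Query.subst_subst _ _ _).symm
      · exact (Subst.comp_assoc _ _ _).symm
    | cmp c a b x y G V σ ha hb hc =>
      rcases ih with ⟨h1, pre, h2, h3⟩ | ih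
      · refine Or.inl ⟨h1, pre ++ [.cmp c a b], by simpa using h2, fun L hL => ?_⟩
        rcases List.mem_append.1 hL with hL | hL
        · exact h3 L hL
        · exact ⟨c, a, b, by simpa using hL⟩
      · refine Or.inr fun π π' hπ => ?_
        obtain ⟨⟨G', V', σ'⟩, h1, h2, h3⟩ := ih π π' hπ
        simp only at h2 h3
        subst h2 h3
        exact ⟨_, Relation.ReflTransGen.tail h1 (.cmp c _ _ x y _ _ _
          (Term.value_subst ha _) (Term.value_subst hb _) hc), rfl, rfl⟩
    | assign t e z G V σ θ he hθ =>
      refine Or.inr fun π π' hπ => ⟨_, hr.tail (.assign t e z G V σ (θ.comp π) he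
        (hθ.comp_renaming (fun σ θ a => (Term.subst_subst _ _ _).symm) hπ)), ?_, ?_⟩
      · exact (Query.subst_subst _ _ _).symm
      · exact (Subst.comp_assoc _ _ _).symm

/-- A query of comparisons only has no answer but the identity: no unifier is ever applied. -/
theorem Reachable.answer_eq_id {P : Program F ar} {Q : Query F ar} {C : Config F ar}
    (h : Reachable P Q C) (hQ : ∀ L ∈ Q, L.IsCmp) : C.answer = Subst.id := by
  suffices h' : C.answer = Subst.id ∧ ∀ L ∈ C.goal, L.IsCmp from h'.1
  induction h with
  | refl => exact ⟨rfl, hQ⟩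
  | tail _ hs ih =>
    cases hs with
    | resolve A G V σ θ r ρ hrP hfresh hθ =>
      obtain ⟨_, _, _, h⟩ := ih.2 _ List.mem_cons_self
      exact absurd h (by simp)
    | cmp c a b x y G V σ ha hb hc =>
      exact ⟨ih.1, fun L hL => ih.2 L (List.mem_cons_of_mem _ hL)⟩
    | assign t e z G V σ θ he hθ =>
      obtain ⟨_, _, _, h⟩ := ih.2 _ List.mem_cons_self
      exact absurd h (by simp)

theorem hasInfiniteDerivation_iff {P : Program F ar} {Q : Query F ar} :
    HasInfiniteDerivation P Q ↔ ¬ Acc (flip (Step P)) (Config.init Q) :=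
  (not_acc_iff_exists_descending_chain (r := flip (Step P))).symm

end

/-! ### Erasing adornments -/

section

variable {F : Type*} {Pr : Type*} {ar : Pr → ℕ}

theorem Atom.mk_inj {q : Pr} {a b : Fin (ar q) → Term F} :
    (⟨q, a⟩ : Atom F ar) = ⟨q, b⟩ ↔ a = b := by
  simp

/-- The atom of the original language that underlies an atom of the adorned program. -/
def Atom.erase : Atom F (adAr ar) → Atom F ar
  | ⟨.inl q, args⟩ => ⟨q, args⟩
  | ⟨.inr a, args⟩ => ⟨a.1, args⟩

def Literal.erase : Literal F (adAr ar) → Literal F ar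
  | .atom A => .atom A.erase
  | .cmp c a b => .cmp c a b
  | .assign t e => .assign t e

def Query.erase (G : Query F (adAr ar)) : Query F ar := G.map Literal.erase

def Clause.erase (r : Clause F (adAr ar)) : Clause F ar := ⟨r.head.erase, Query.erase r.body⟩

def Config.erase (C : Config F (adAr ar)) : Config F ar := ⟨Query.erase C.goal, C.used, C.answer⟩

theorem Atom.erase_subst (θ : ℕ → Term F) (A : Atom F (adAr ar)) :
    (A.subst θ).erase = A.erase.subst θ := by
  obtain ⟨q | a, args⟩ := A <;> rfl

theorem Literal.erase_subst (θ : ℕ → Term F) (L : Literal F (adAr ar)) :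
    (L.subst θ).erase = L.erase.subst θ := by
  cases L with
  | atom A => exact congrArg Literal.atom (Atom.erase_subst θ A)
  | cmp c a b => rfl
  | assign t e => rfl

theorem Query.erase_subst (θ : ℕ → Term F) (G : Query F (adAr ar)) :
    Query.erase (Query.subst θ G) = Query.subst θ (Query.erase G) := by
  simp [Query.erase, Query.subst, Literal.erase_subst]

theorem Query.erase_append (G H : Query F (adAr ar)) :
    Query.erase (G ++ H) = Query.erase G ++ Query.erase H := List.map_append

theorem Atom.vars_erase (A : Atom F (adAr ar)) : A.erase.vars = A.vars := by
  obtain ⟨q | a, args⟩ := A <;> rfl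

theorem Literal.vars_erase (L : Literal F (adAr ar)) : L.erase.vars = L.vars := by
  cases L with
  | atom A => exact Atom.vars_erase A
  | cmp c a b => rfl
  | assign t e => rfl

theorem Query.vars_erase (G : Query F (adAr ar)) : Query.vars (Query.erase G) = Query.vars G := by
  ext y
  simp [Query.mem_vars, Query.erase, Literal.vars_erase]

theorem Clause.vars_erase (r : Clause F (adAr ar)) : r.erase.vars = r.vars := by
  simp [Clause.vars, Clause.erase, Atom.vars_erase, Query.vars_erase]

theorem Clause.erase_rename (ρ : Equiv.Perm ℕ) (r : Clause F (adAr ar)) :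
    (r.rename ρ).erase = r.erase.rename ρ := by
  refine Clause.mk.injEq .. ▸ ⟨Atom.erase_subst _ _, Query.erase_subst _ _⟩

theorem Atom.eq_iff_erase_eq {A B : Atom F (adAr ar)} (h : A.rel = B.rel) :
    A = B ↔ A.erase = B.erase := by
  refine ⟨congrArg _, fun he => ?_⟩
  obtain ⟨p, a⟩ := A
  obtain ⟨q, b⟩ := B
  obtain rfl : p = q := h
  rcases p with q | p
  · exact Atom.mk_inj.2 (Atom.mk_inj (ar := ar) (q := q).1 he)
  · exact Atom.mk_inj.2 (Atom.mk_inj (ar := ar) (q := p.1).1 he)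

theorem isMGU_erase_iff {A B : Atom F (adAr ar)} (h : A.rel = B.rel) {θ : Subst F} :
    IsMGU Atom.subst θ A.erase B.erase ↔ IsMGU Atom.subst θ A B := by
  have key : ∀ η : Subst F,
      A.erase.subst η.toFun = B.erase.subst η.toFun ↔ A.subst η.toFun = B.subst η.toFun :=
    fun η => by
      rw [← Atom.erase_subst, ← Atom.erase_subst]
      exact (Atom.eq_iff_erase_eq (A := A.subst η.toFun) (B := B.subst η.toFun) h).symm
  simp only [IsMGU, key]

theorem Config.wf_erase_iff {V₀ : Finset ℕ} {C : Config F (adAr ar)} :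
    C.erase.WF V₀ ↔ C.WF V₀ := by
  refine ⟨fun h => ⟨h.finite, fun x hx => h.goal x ?_, h.answer⟩,
    fun h => ⟨h.finite, fun x hx => h.goal x ?_, h.answer⟩⟩
  · exact (Query.vars_erase C.goal).symm ▸ hx
  · exact Query.vars_erase C.goal ▸ hx

theorem Config.HasInstance.erase {V₀ : Finset ℕ} {C D : Config F (adAr ar)}
    (h : C.HasInstance V₀ D) : C.erase.HasInstance V₀ D.erase := by
  obtain ⟨η, h1, h2⟩ := h
  exact ⟨η, h1, (congrArg Query.erase h2).trans (Query.erase_subst _ _)⟩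

theorem Config.Variant.erase {V₀ : Finset ℕ} {C D : Config F (adAr ar)}
    (h : C.Variant V₀ D) : C.erase.Variant V₀ D.erase := ⟨h.1.erase, h.2.erase⟩

theorem Query.erase_embed (Q : Query F ar) : Query.erase (Query.embed Q) = Q := by
  rw [Query.erase, Query.embed, List.map_map]
  refine (List.map_congr_left fun L _ => ?_).trans (List.map_id Q)
  cases L <;> rfl

theorem Query.vars_embed (Q : Query F ar) : Query.vars (Query.embed Q) = Query.vars Q := by
  rw [← Query.vars_erase, Query.erase_embed]

theorem Config.erase_init_embed (Q : Query F ar) :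
    (Config.init (Query.embed Q)).erase = Config.init Q := by
  simp [Config.init, Config.erase, Query.erase_embed, Query.vars_embed]

theorem Query.isCmp_of_embed {Q : Query F ar} (h : ∀ L ∈ Query.embed Q, L.IsCmp) :
    ∀ L ∈ Q, L.IsCmp := by
  intro (L : Literal F ar) hL
  obtain ⟨c, a, b, he⟩ := h L.embed (List.mem_map_of_mem hL)
  cases L with
  | cmp c a b => exact ⟨c, a, b, rfl⟩
  | _ => simp [Literal.embed] at he

theorem Query.isCmp_embed {Q : Query F ar} (h : ∀ L ∈ Q, L.IsCmp) :
    ∀ L ∈ Query.embed Q, L.IsCmp := by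
  intro L hL
  obtain ⟨L', hL', rfl⟩ := List.mem_map.1 hL
  obtain ⟨c, a, b, rfl⟩ := h L' hL'
  exact ⟨c, a, b, rfl⟩

theorem AdornAtom.erase_eq {E : Set Pr} {𝒜 : (q : Pr) → Finset (SymCond (ar q))} {A : Atom F ar}
    {A' : Atom F (adAr ar)} (h : AdornAtom E 𝒜 A A') : A'.erase = A := by
  cases h <;> rfl

theorem AdornLiteral.erase_eq {E : Set Pr} {𝒜 : (q : Pr) → Finset (SymCond (ar q))}
    {L : Literal F ar} {L' : Literal F (adAr ar)} (h : AdornLiteral E 𝒜 L L') :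
    L'.erase = L := by
  cases h with
  | atom A A' h => exact congrArg Literal.atom h.erase_eq
  | cmp c a b => rfl
  | assign t e => rfl

theorem Query.erase_eq_of_adorn {E : Set Pr} {𝒜 : (q : Pr) → Finset (SymCond (ar q))}
    {G : Query F ar} {G' : Query F (adAr ar)} (h : List.Forall₂ (AdornLiteral E 𝒜) G G') :
    Query.erase G' = G := by
  induction h with
  | nil => rfl
  | cons h _ ih => exact congrArg₂ List.cons h.erase_eq ih

theorem Clause.erase_mem {P : Program F ar} {R : Set Pr} {𝒜 : (q : Pr) → Finset (SymCond (ar q))}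
    {r' : Clause F (adAr ar)} (h : r' ∈ adornedProgram P R 𝒜) : r'.erase ∈ P := by
  obtain ⟨r, hr, hhead, hbody, -⟩ := h
  have : r'.erase = r := Clause.mk.injEq .. ▸ ⟨hhead.erase_eq, Query.erase_eq_of_adorn hbody⟩
  rwa [this]

/-! ### Resolution with adorned rules and with bridging clauses -/

variable {P : Program F ar} {R : Set Pr} {𝒜 : (q : Pr) → Finset (SymCond (ar q))}
  {V₀ : Finset ℕ}

/-- Resolution with a bridging clause only adorns the selected atom, up to variants. -/
theorem variant_of_bridging {q : Pr} {c : SymCond (ar q)} {args : Fin (ar q) → Term F}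
    {G : Query F (adAr ar)} {V W : Set ℕ} {σ θ : Subst F} {ρ : Equiv.Perm ℕ}
    (hC : Config.WF V₀ ⟨.atom ⟨.inl q, args⟩ :: G, V, σ⟩)
    (hfresh : Disjoint (↑((bridgingClause F q c).rename ρ).vars : Set ℕ) V)
    (hθ : IsMGU Atom.subst θ ⟨.inl q, args⟩ ((bridgingClause F q c).rename ρ).head) :
    Config.Variant V₀
      ⟨(((bridgingClause F q c).rename ρ).body ++ G).map (Literal.subst θ.toFun), W, σ.comp θ⟩
      ⟨.atom ⟨.inr ⟨q, c⟩, args⟩ :: G, V, σ⟩ := by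
  constructor
  · obtain ⟨ζ, hζ, hhead, hbody⟩ := Clause.exists_merge hfresh Subst.id
      (fun x => if h : x < ar q then args ⟨x, h⟩ else .var x)
    have hid : ∀ L ∈ Literal.atom ⟨.inl q, args⟩ :: G, Literal.subst ζ.toFun L = L := fun L hL =>
      (Literal.subst_congr fun x hx => hζ x (hC.goal x (Query.mem_vars.2 ⟨L, hL, hx⟩))).trans
        L.subst_var
    have hA := Literal.atom.inj (hid _ List.mem_cons_self)
    obtain ⟨γ, rfl⟩ := hθ.2 ζ (by
      rw [hA, hhead]
      simp [bridgingClause, Atom.subst, Term.subst, adAr])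
    refine ⟨γ, fun x hx => ?_, ?_⟩
    · change σ.toFun x = ((σ.toFun x).subst θ.toFun).subst γ.toFun
      rw [← Subst.subst_comp]
      refine Eq.symm (Eq.trans (Term.subst_eq_subst_iff.2 fun y hy => hζ y ?_) (Term.subst_var _))
      exact hC.answer x hx y hy
    · change _ = Query.subst _ (Query.subst _ _)
      rw [Query.subst_append, Query.subst_append]
      refine congrArg₂ (· ++ ·) (x := [Literal.atom ⟨.inr ⟨q, c⟩, args⟩])
        ((Eq.trans ?_ hbody.symm).trans (Query.subst_subst _ _ _).symm) ?_
      · simp [bridgingClause, Query.subst, Literal.subst, Atom.subst, Term.subst, adAr]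
      · rw [Query.subst_subst]
        refine Eq.symm ((List.map_congr_left fun L hL => ?_).trans (List.map_id G))
        exact hid L (List.mem_cons_of_mem _ hL)
  · refine ⟨θ, fun x hx => rfl, ?_⟩
    have h : (fun i => (args i).subst θ.toFun) = fun i : Fin (ar q) => θ.toFun (ρ i) :=
      Atom.mk_inj (ar := adAr ar) (q := .inl q).1 hθ.1
    exact congrArg (fun ts : Fin (ar q) → Term F => (Literal.atom
      (⟨Sum.inr ⟨q, c⟩, ts⟩ : Atom F (adAr ar)) :: Query.subst θ.toFun G)) h.symm

theorem exists_bridging_step {q : Pr} {c : SymCond (ar q)} {args : Fin (ar q) → Term F}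
    {G : Query F (adAr ar)} {V : Set ℕ} {σ : Subst F}
    (hC : Config.WF V₀ ⟨.atom ⟨.inl q, args⟩ :: G, V, σ⟩) (hq : q ∈ adornedPreds P R)
    (hc : c ∈ 𝒜 q) :
    ∃ D, Step (extendedProgram P R 𝒜) ⟨.atom ⟨.inl q, args⟩ :: G, V, σ⟩ D ∧
      D.Variant V₀ ⟨.atom ⟨.inr ⟨q, c⟩, args⟩ :: G, V, σ⟩ := by
  obtain ⟨ρ, hfresh⟩ := (bridgingClause F q c).exists_fresh_rename hC.finite
  obtain ⟨ζ, hζ, hhead, -⟩ := Clause.exists_merge hfresh Subst.id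
    (fun x => if h : x < ar q then args ⟨x, h⟩ else .var x)
  obtain ⟨θ, hθ⟩ := Atom.exists_mgu (A := (⟨.inl q, args⟩ : Atom F (adAr ar)))
    (B := ((bridgingClause F q c).rename ρ).head) ⟨ζ, by
      rw [hhead, Atom.subst_congr (η := Term.var) fun x hx => hζ x (hC.goal x
        (Query.mem_vars.2 ⟨_, List.mem_cons_self, hx⟩))]
      simp [bridgingClause, Atom.subst, Term.subst, adAr]⟩
  exact ⟨_, .resolve _ G V σ θ _ ρ (Or.inr ⟨q, hq, c, hc, rfl⟩) hfresh hθ,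
    variant_of_bridging hC hfresh hθ⟩

/-- A step of the extended program either erases to a step of the original program or adorns the
selected atom. -/
theorem Step.erase_or_bridging {C D : Config F (adAr ar)} (hC : C.WF V₀)
    (h : Step (extendedProgram P R 𝒜) C D) :
    Step P C.erase D.erase ∨ ∃ q c args G, C.goal = .atom ⟨.inl q, args⟩ :: G ∧
      D.Variant V₀ ⟨.atom ⟨.inr ⟨q, c⟩, args⟩ :: G, C.used, C.answer⟩ := by
  cases h with
  | resolve A G V σ θ r ρ hr hfresh hθ =>
    rcases hr with hr | ⟨q, hq, c, hc, rfl⟩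
    · left
      have hrel : A.rel = (r.rename ρ).head.rel := by
        have h := congrArg Atom.rel hθ.1
        exact h
      have := Step.resolve A.erase (Query.erase G) V σ θ r.erase ρ (Clause.erase_mem hr)
        (by rw [← Clause.erase_rename, Clause.vars_erase]; exact hfresh)
        (by rw [← Clause.erase_rename]; exact (isMGU_erase_iff hrel).2 hθ)
      refine Eq.mp (congrArg (Step P _) (Eq.symm ?_)) this
      refine Config.mk.injEq .. ▸ ⟨?_, ?_, rfl⟩
      · refine (Query.erase_subst _ _).trans ?_
        rw [Query.erase_append, ← Clause.erase_rename]
        rfl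
      · change V ∪ _ ∪ _ = _
        rw [← Clause.erase_rename, Clause.vars_erase]
    · right
      obtain ⟨p, args⟩ := A
      obtain rfl : p = .inl q := congrArg Atom.rel hθ.1
      exact ⟨q, c, args, G, rfl, variant_of_bridging hC hfresh hθ⟩
  | cmp c a b x y G V σ ha hb hc => exact Or.inl (.cmp c a b x y _ V σ ha hb hc)
  | assign t e z G V σ θ he hθ =>
    left
    have := Step.assign (P := P) t e z (Query.erase G) V σ θ he hθ
    exact Eq.mp (congrArg (Step P _) (Eq.symm
      (Config.mk.injEq .. ▸ ⟨Query.erase_subst _ _, rfl, rfl⟩))) this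

/-- The original configuration `C` is simulated by the configuration `C'` of the extended
program: up to variants, `C'` is obtained from `C` by adorning atoms of the goal. -/
def Simulates (V₀ : Finset ℕ) (C : Config F ar) (C' : Config F (adAr ar)) : Prop :=
  ∃ X : Config F (adAr ar), X.erase = C ∧ X.Variant V₀ C'

/-- Every step of the extended program is matched by a step of the original program, or else it
adorns the selected atom. -/
theorem Simulates.step {C : Config F ar} {C' D' : Config F (adAr ar)} (h : Simulates V₀ C C')
    (hC : C.WF V₀) (hC' : C'.WF V₀) (hs : Step (extendedProgram P R 𝒜) C' D') :
    (∃ D, Step P C D ∧ Simulates V₀ D D') ∨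
      (Simulates V₀ C D' ∧ (∃ q args G, C'.goal = .atom ⟨.inl q, args⟩ :: G) ∧
        ∃ a args G, D'.goal = .atom ⟨.inr a, args⟩ :: G) := by
  obtain ⟨X, rfl, hX⟩ := h
  have hXwf := Config.wf_erase_iff.1 hC
  obtain ⟨Y, hY, hYD⟩ := hs.exists_variant hX hXwf hC'
  rcases hY.erase_or_bridging hXwf with hY | ⟨q, c, args, G, hG, hv⟩
  · exact Or.inl ⟨_, hY, Y, rfl, hYD⟩
  · refine Or.inr ⟨⟨_, ?_, hv.symm.trans hYD⟩, ?_, ?_⟩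
    · simp only [Config.erase, hG]
      rfl
    · obtain ⟨η, -, h⟩ := hX.1
      rw [hG] at h
      exact ⟨q, _, _, h⟩
    · obtain ⟨η, -, h⟩ := (hv.symm.trans hYD).1
      exact ⟨⟨q, c⟩, _, _, h⟩

/-- Adorning steps are never consecutive, so that an infinite derivation of the extended program
yields infinitely many steps of the original program. -/
theorem Simulates.acc {C : Config F ar} (hacc : Acc (flip (Step P)) C) :
    ∀ {C' : Config F (adAr ar)}, Simulates V₀ C C' → C.WF V₀ → C'.WF V₀ →
      Acc (flip (Step (extendedProgram P R 𝒜))) C' := by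
  induction hacc with
  | intro C _ ih =>
    intro C' h hC hC'
    refine ⟨_, fun D' hD' => ?_⟩
    rcases h.step hC hC' hD' with ⟨D, hD, hsim⟩ | ⟨hsim, -, a, args, G, hG⟩
    · exact ih D hD hsim (hD.wf hC) (Step.wf hD' hC')
    · refine ⟨_, fun E' hE' => ?_⟩
      rcases hsim.step hC (Step.wf hD' hC') hE' with ⟨D, hD, hsim'⟩ | ⟨-, ⟨q, args', G', hG'⟩, -⟩
      · exact ih D hD hsim' (hD.wf hC) (Step.wf hE' (Step.wf hD' hC'))
      · rw [hG] at hG'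
        simp at hG'

theorem Reachable.exists_simulates {Q : Query F ar} {C' : Config F (adAr ar)}
    (h : Reachable (extendedProgram P R 𝒜) (Query.embed Q) C') :
    ∃ C, Reachable P Q C ∧ Simulates (Query.vars Q) C C' := by
  induction h with
  | refl => exact ⟨_, .refl, _, Config.erase_init_embed Q, Config.Variant.refl _ _⟩
  | tail hr hs ih =>
    obtain ⟨C, hC, hsim⟩ := ih
    rcases hsim.step (Reachable.wf hC) (Query.vars_embed Q ▸ Reachable.wf hr) hs with
      ⟨D, hD, hsim'⟩ | ⟨hsim', -⟩
    · exact ⟨D, Relation.ReflTransGen.tail hC hD, hsim'⟩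
    · exact ⟨C, hC, hsim'⟩

/-- Computed answers are invariant under variants. The last hypothesis accounts for derivations
without unifiers, the answer of which cannot be renamed. -/
theorem IsComputedAnswer.of_variant {Pr' : Type*} {ar' : Pr' → ℕ} {P' : Program F ar'}
    {Q : Query F ar'} {X C : Config F ar'} (hv : C.Variant (Query.vars Q) X)
    (hC : Reachable P' Q C) (hgoal : C.goal = [])
    (hid : (∀ L ∈ Q, L.IsCmp) → X.answer = Subst.id) :
    IsComputedAnswer P' Q (X.answer.restrict (Query.vars Q)) := by
  rcases hC.answer_eq_id_or_rename with ⟨h1, pre, h2, h3⟩ | h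
  · rw [hgoal, List.append_nil] at h2
    subst h2
    exact ⟨C, hC, hgoal, by rw [hid h3, h1]⟩
  · obtain ⟨π, π', hπ, hans⟩ := hv.exists_renaming
    obtain ⟨C', hC', hg, ha⟩ := h π π' hπ
    refine ⟨C', hC', by rw [hg, hgoal]; rfl, ?_⟩
    ext x
    simp only [Subst.restrict]
    split_ifs with hx
    · rw [ha, hans x hx]
      rfl
    · rfl

theorem IsComputedAnswer.of_extendedProgram {Q : Query F ar} {σ : Subst F}
    (h : IsComputedAnswer (extendedProgram P R 𝒜) (Query.embed Q) σ) :
    IsComputedAnswer P Q σ := by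
  obtain ⟨C', hC', hgoal, rfl⟩ := h
  obtain ⟨C, hC, X, rfl, hX⟩ := Reachable.exists_simulates hC'
  rw [Query.vars_embed]
  refine IsComputedAnswer.of_variant (X := C'.erase) hX.erase hC ?_ fun h => ?_
  · obtain ⟨η, -, h⟩ := hX.2
    change Query.erase X.goal = []
    rw [h, hgoal]
    rfl
  · exact hC'.answer_eq_id (Query.isCmp_embed h)

theorem HasInfiniteDerivation.of_extendedProgram {Q : Query F ar}
    (h : HasInfiniteDerivation (extendedProgram P R 𝒜) (Query.embed Q)) :
    HasInfiniteDerivation P Q := by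
  rw [hasInfiniteDerivation_iff] at h ⊢
  exact fun hacc => h (Simulates.acc hacc
    ⟨_, Config.erase_init_embed Q, Config.Variant.refl (Query.vars Q) _⟩ (Config.WF.init Q)
    (Query.vars_embed Q ▸ Config.WF.init _))

end

section

variable {F : Type*} {Pr : Type*} {ar : Pr → ℕ}

/-! ### Foreseen integer values -/

/-- A prophecy records with increasing accuracy `k` the integer values which the variables will
receive in the rest of a derivation: values are only ever added. -/
def IsProphecy (μ : ℕ → ℕ → Option ℤ) : Prop :=
  ∀ k x z, μ k x = some z → μ (k + 1) x = some z

theorem IsProphecy.eval_mono {μ : ℕ → ℕ → Option ℤ} (hμ : IsProphecy μ) {k l : ℕ} (hkl : k ≤ l)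
    {t : Term F} {z : ℤ} (h : t.eval (μ k) = some z) : t.eval (μ l) = some z := by
  induction l, hkl using Nat.le_induction with
  | base => exact h
  | succ l _ ih => exact Term.eval_mono (hμ l) ih

theorem IsProphecy.eval_unique {μ : ℕ → ℕ → Option ℤ} (hμ : IsProphecy μ) {k l : ℕ}
    {t : Term F} {z w : ℤ} (h : t.eval (μ k) = some z) (h' : t.eval (μ l) = some w) : z = w :=
  Option.some.inj <| (hμ.eval_mono (le_max_left k l) h).symm.trans
    (hμ.eval_mono (le_max_right k l) h')

/-- The prophecy before a step with unifier `θ`, given the prophecy after it. -/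
def pullProphecy (θ : ℕ → Term F) (μ : ℕ → ℕ → Option ℤ) : ℕ → ℕ → Option ℤ
  | 0, _ => none
  | k + 1, x => (θ x).eval (μ k)

/-- The adornment of an atom is correct for the values that its arguments will receive. -/
def Atom.Foreseen (E : Set Pr) (𝒜 : (q : Pr) → Finset (SymCond (ar q)))
    (μ : ℕ → ℕ → Option ℤ) : Atom F (adAr ar) → Prop
  | ⟨.inl _, _⟩ => True
  | ⟨.inr a, args⟩ => a.1 ∈ E ∧ a.2 ∈ 𝒜 a.1 ∧ ∃ d : Fin (ar a.1) → ℤ,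
      (∀ (i : Fin (ar a.1)) (k : ℕ) (z : ℤ), Term.eval (μ k) (args i) = some z → d i = z) ∧
      a.2.Holds d

def Query.Foreseen (E : Set Pr) (𝒜 : (q : Pr) → Finset (SymCond (ar q)))
    (μ : ℕ → ℕ → Option ℤ) (G : Query F (adAr ar)) : Prop :=
  ∀ A, Literal.atom A ∈ G → A.Foreseen E 𝒜 μ

theorem Atom.Foreseen.subst {E : Set Pr} {𝒜 : (q : Pr) → Finset (SymCond (ar q))}
    {μ : ℕ → ℕ → Option ℤ} {θ : ℕ → Term F} {A : Atom F (adAr ar)}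
    (h : A.Foreseen E 𝒜 (pullProphecy θ μ)) : (A.subst θ).Foreseen E 𝒜 μ := by
  obtain ⟨q | a, args⟩ := A
  · trivial
  · obtain ⟨hE, hc, d, hd, hH⟩ := h
    exact ⟨hE, hc, d, fun i k z hz => hd i (k + 1) z ((Term.eval_subst _ _ _).symm.trans hz), hH⟩

theorem Query.Foreseen.subst {E : Set Pr} {𝒜 : (q : Pr) → Finset (SymCond (ar q))}
    {μ : ℕ → ℕ → Option ℤ} {θ : ℕ → Term F} {G : Query F (adAr ar)}
    (h : Query.Foreseen E 𝒜 (pullProphecy θ μ) G) :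
    Query.Foreseen E 𝒜 μ (Query.subst θ G) := by
  intro A hA
  obtain ⟨L, hL, hLA⟩ := List.mem_map.1 hA
  cases L with
  | atom B =>
    obtain rfl := Literal.atom.inj hLA
    exact (h B hL).subst
  | _ => simp [Literal.subst] at hLA

theorem SymExpr.eval_congr {n : ℕ} {d d' : Fin n → ℤ} {a : SymExpr n}
    (h : ∀ i ∈ a.positions, d i = d' i) : a.eval d = a.eval d' := by
  induction a with
  | pos i => exact congrArg some (h i rfl)
  | int z => rfl
  | neg a ih => simp only [eval, ih h]
  | op o a b iha ihb =>
    simp only [eval, iha fun i hi => h i (Or.inl hi), ihb fun i hi => h i (Or.inr hi)]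

theorem SymCond.holds_congr {n : ℕ} {d d' : Fin n → ℤ} {c : SymCond n}
    (h : ∀ i ∈ c.positions, d i = d' i) : c.Holds d ↔ c.Holds d' := by
  induction c with
  | ineq r a b =>
    simp only [Holds, SymExpr.eval_congr fun i hi => h i (Or.inl hi),
      SymExpr.eval_congr fun i hi => h i (Or.inr hi)]
  | tru => rfl
  | not c ih => exact not_congr (ih h)
  | and c e ihc ihe =>
    exact and_congr (ihc fun i hi => h i (Or.inl hi)) (ihe fun i hi => h i (Or.inr hi))
  | or c e ihc ihe =>
    exact or_congr (ihc fun i hi => h i (Or.inl hi)) (ihe fun i hi => h i (Or.inr hi))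

/-! ### Choice of adorned rules -/

/-- A prophecy for the instance of a clause by `τ` gives integer values to the variables of the
clause. Variables without a foreseen integer value receive the value `0`. -/
theorem IsProphecy.exists_assignment {μ : ℕ → ℕ → Option ℤ} (hμ : IsProphecy μ)
    (τ : ℕ → Term F) : ∃ ν : ℕ → ℤ, ∀ (t : Term F) (k : ℕ) (z : ℤ),
      (t.subst τ).eval (μ k) = some z → t.eval (fun v => some (ν v)) = some z := by
  classical
  refine ⟨fun x => if h : ∃ k z, (τ x).eval (μ k) = some z then h.choose_spec.choose else 0,
    fun t k z hz => ?_⟩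
  rw [Term.eval_subst] at hz
  refine Term.eval_mono (fun x w hw => ?_) hz
  have h : ∃ k z, (τ x).eval (μ k) = some z := ⟨k, w, hw⟩
  exact congrArg some ((dif_pos h).trans (hμ.eval_unique h.choose_spec.choose_spec hw))

/-- A body atom is given an adornment that is true of the values of its arguments under the
assignment `ν`. It is then satisfied in the consistency check and correct for every value that
the instance of the atom by `τ` is foreseen to have. -/
theorem exists_adornLiteral {E : Set Pr} {𝒜 : (q : Pr) → Finset (SymCond (ar q))}
    (htotal : ∀ q ∈ E, ∀ d : Fin (ar q) → ℤ, ∃ c ∈ 𝒜 q, c.Holds d) {μ : ℕ → ℕ → Option ℤ}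
    {τ : ℕ → Term F} {ν : ℕ → ℤ} (hν : ∀ (t : Term F) (k : ℕ) (z : ℤ),
      (t.subst τ).eval (μ k) = some z → t.eval (fun v => some (ν v)) = some z)
    (L : Literal F ar) : ∃ L' : Literal F (adAr ar), AdornLiteral E 𝒜 L L' ∧
      ∀ B, L' = .atom B → B.AdornmentTrue ν ∧ (B.subst τ).Foreseen E 𝒜 μ := by
  cases L with
  | cmp c a b => exact ⟨_, .cmp c a b, by simp⟩
  | assign t e => exact ⟨_, .assign t e, by simp⟩
  | atom A =>
    obtain ⟨q, args⟩ := A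
    by_cases hq : q ∈ E
    · obtain ⟨c, hc, hH⟩ := htotal q hq
        fun i => ((args i).eval (fun v => some (ν v))).getD 0
      refine ⟨_, .atom _ _ (.adorn q args hq c hc), ?_⟩
      rintro B hB
      obtain rfl := Literal.atom.inj hB
      exact ⟨⟨_, fun i z hz => congrArg (fun o : Option ℤ => o.getD 0) hz, hH⟩, hq, hc, _,
        fun i k z hz => congrArg (fun o : Option ℤ => o.getD 0) (hν (args i) k z hz), hH⟩
    · refine ⟨_, .atom _ _ (.keep q args hq), ?_⟩
      rintro B hB
      obtain rfl := Literal.atom.inj hB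
      exact ⟨trivial, trivial⟩

/-- All comparisons at the beginning of the goal succeed at run-time. -/
def Query.RunsTrue (G : Query F ar) : Prop :=
  ∀ pre rest, G = pre ++ rest → (∀ L ∈ pre, L.IsCmp) → ∀ c a b, Literal.cmp c a b ∈ pre →
    ∃ x y, a.value = some x ∧ b.value = some y ∧ c.Holds x y

/-- If the comparisons at the beginning of the instance of a body by `τ` succeed at run-time, then
those of the maximal prefix are true under an assignment that agrees with the foreseen values. -/
theorem cmpTrue_of_mem_maxPrefix {μ : ℕ → ℕ → Option ℤ} {τ : ℕ → Term F} {ν : ℕ → ℤ}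
    (hν : ∀ (t : Term F) (k : ℕ) (z : ℤ),
      (t.subst τ).eval (μ k) = some z → t.eval (fun v => some (ν v)) = some z)
    {r : Clause F (adAr ar)} {G : Query F ar}
    (hrun : Query.RunsTrue (Query.subst τ (Query.erase r.body) ++ G)) :
    ∀ L ∈ r.maxPrefix, L.CmpTrue ν := by
  have hcmp : ∀ L ∈ r.maxPrefix, L.IsCmp := by
    intro L hL
    have := List.mem_takeWhile_imp hL
    cases L with
    | cmp c a b => exact ⟨c, a, b, rfl⟩
    | _ => simp [Literal.isPrefixInequality] at this
  intro L hL
  obtain ⟨c, a, b, rfl⟩ := hcmp L hL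
  have hvalue : ∀ {t : Term F} {z : ℤ}, (t.subst τ).value = some z →
      t.eval (fun v => some (ν v)) = some z := fun {t z} hz =>
    hν t 0 z (Term.eval_mono (by simp) hz)
  have hbody : r.body = r.maxPrefix ++
      r.body.dropWhile (Literal.isPrefixInequality r.head.vars) :=
    List.takeWhile_append_dropWhile.symm
  obtain ⟨x, y, hx, hy, hc⟩ := hrun (Query.subst τ (Query.erase r.maxPrefix)) _
    (by
      conv_lhs => rw [hbody]
      rw [Query.erase_append, Query.subst_append, List.append_assoc])
    (by
      intro L hL
      obtain ⟨L₁, hL₁, rfl⟩ := List.mem_map.1 hL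
      obtain ⟨L₂, hL₂, rfl⟩ := List.mem_map.1 hL₁
      obtain ⟨c, a, b, rfl⟩ := hcmp L₂ hL₂
      exact ⟨c, _, _, rfl⟩)
    c (a.subst τ) (b.subst τ)
    (List.mem_map_of_mem (f := Literal.subst τ) (List.mem_map_of_mem (f := Literal.erase) hL))
  exact ⟨x, y, hvalue hx, hvalue hy, hc⟩

variable {P : Program F ar} {Q : Query F ar} {R : Set Pr}
  {𝒜 : (q : Pr) → Finset (SymCond (ar q))}

/-- If the adornment of the selected atom is correct, and the prefix of the rule used for it
succeeds, then the rule has a consistent adorned version in which all adornments are correct. The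
conditions only speak about integer argument positions, and these hold integers in the selected
atom; hence they do not depend on the values chosen for the other positions. -/
theorem exists_adorned_rule
    (h𝒜 : ∀ q ∈ adornedPreds P R, IsSetOfAdornments P Q q (𝒜 q)) {A : Atom F (adAr ar)}
    (hcall : IsCall P Q A.erase) {r : Clause F ar} (hr : r ∈ P) {θ τ : ℕ → Term F}
    (hunif : A.erase.subst θ = r.head.subst τ) {μ : ℕ → ℕ → Option ℤ} (hμ : IsProphecy μ)
    {G : Query F ar} (hrun : Query.RunsTrue (Query.subst τ r.body ++ G))
    (hA : A.Foreseen (adornedPreds P R) 𝒜 (pullProphecy θ μ))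
    (hinl : ∀ q, A.rel = .inl q → q ∉ adornedPreds P R) :
    ∃ r' ∈ adornedProgram P R 𝒜, r'.erase = r ∧ r'.head.rel = A.rel ∧
      Query.Foreseen (adornedPreds P R) 𝒜 μ (Query.subst τ r'.body) := by
  obtain ⟨ν, hν⟩ := hμ.exists_assignment τ
  have hlit := exists_adornLiteral (E := adornedPreds P R) (𝒜 := 𝒜)
    (fun q hq => (h𝒜 q hq).2.2) hν
  choose f hf hf' using hlit
  have hbody : List.Forall₂ (AdornLiteral (adornedPreds P R) 𝒜) r.body (r.body.map f) := by
    rw [List.forall₂_map_right_iff, List.forall₂_same]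
    exact fun L _ => hf L
  have herase := Query.erase_eq_of_adorn hbody
  have hfore : Query.Foreseen (adornedPreds P R) 𝒜 μ (Query.subst τ (r.body.map f)) := by
    intro B hB
    obtain ⟨L, hL, hLB⟩ := List.mem_map.1 hB
    obtain ⟨L, -, rfl⟩ := List.mem_map.1 hL
    cases hfL : f L with
    | atom A =>
      rw [hfL] at hLB
      obtain rfl := Literal.atom.inj hLB
      exact (hf' L A hfL).2
    | _ => rw [hfL] at hLB; simp [Literal.subst] at hLB
  have htrue : ∀ B, Literal.atom B ∈ r.body.map f → B.AdornmentTrue ν := by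
    intro B hB
    obtain ⟨L, -, hL⟩ := List.mem_map.1 hB
    exact (hf' L B hL).1
  have hprefix : ∀ head : Atom F (adAr ar), ∀ L ∈ Clause.maxPrefix ⟨head, r.body.map f⟩,
      L.CmpTrue ν := fun head =>
    cmpTrue_of_mem_maxPrefix hν (r := ⟨head, r.body.map f⟩) (by rw [herase]; exact hrun)
  obtain ⟨⟨p, ts⟩, body⟩ := r
  obtain ⟨q | ⟨q, c⟩, args⟩ := A
  · obtain rfl : q = p := congrArg Atom.rel hunif
    exact ⟨⟨⟨.inl q, ts⟩, body.map f⟩,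
      ⟨_, hr, .keep q ts (hinl q rfl), hbody, ν, hprefix _, htrue, trivial⟩,
      Clause.mk.injEq .. ▸ ⟨rfl, herase⟩, rfl, hfore⟩
  · obtain rfl : q = p := congrArg Atom.rel hunif
    obtain ⟨hq, hc, d, hd, hH⟩ := hA
    have hts : ∀ i : Fin (ar q), (args i).subst θ = (ts i).subst τ :=
      congrFun (Atom.mk_inj (q := q).1 hunif)
    -- At the positions in the condition, the head takes the integers of the selected atom.
    have hint : ∀ i ∈ c.positions, (ts i).eval (fun v => some (ν v)) = some (d i) := by
      intro i hi
      obtain ⟨z, hz⟩ := (h𝒜 q hq).1 c hc i hi args hcall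
      refine hν _ 0 _ ?_
      rw [← hts, hz, hd i 0 z (by rw [hz]; rfl)]
      rfl
    classical
    refine ⟨⟨⟨.inr ⟨q, c⟩, ts⟩, body.map f⟩,
      ⟨_, hr, .adorn q ts hq c hc, hbody, ν, hprefix _, htrue,
        fun i => if i ∈ c.positions then d i
          else ((ts i).eval (fun v => some (ν v))).getD 0, fun i z hz => ?_, ?_⟩,
      Clause.mk.injEq .. ▸ ⟨rfl, herase⟩, rfl, hfore⟩
    · beta_reduce
      split_ifs with hi
      · exact Option.some.inj ((hint i hi).symm.trans hz)
      · exact congrArg (fun o : Option ℤ => o.getD 0) hz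
    · exact (SymCond.holds_congr fun i hi => (if_pos hi).symm).1 hH

/-! ### Simulation of the original program by the extended program -/

/-- A resolution step whose selected atom is not to be adorned any more is matched by a single
step of the extended program, with the same variant and the same unifier. -/
theorem exists_adorned_step
    (h𝒜 : ∀ q ∈ adornedPreds P R, IsSetOfAdornments P Q q (𝒜 q)) {A : Atom F (adAr ar)}
    {G : Query F (adAr ar)} {V : Set ℕ} {σ θ : Subst F} {r : Clause F ar} {ρ : Equiv.Perm ℕ}
    (hcall : IsCall P Q A.erase) (hr : r ∈ P)
    (hfresh : Disjoint (↑(r.rename ρ).vars : Set ℕ) V)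
    (hθ : IsMGU Atom.subst θ A.erase (r.rename ρ).head) {μ : ℕ → ℕ → Option ℤ}
    (hμ : IsProphecy μ)
    (hrun : Query.RunsTrue (((r.rename ρ).body ++ Query.erase G).map (Literal.subst θ.toFun)))
    (hA : A.Foreseen (adornedPreds P R) 𝒜 (pullProphecy θ.toFun μ))
    (hG : Query.Foreseen (adornedPreds P R) 𝒜 (pullProphecy θ.toFun μ) G)
    (hinl : ∀ q, A.rel = .inl q → q ∉ adornedPreds P R) :
    ∃ Y : Config F (adAr ar),
      Y.erase = ⟨((r.rename ρ).body ++ Query.erase G).map (Literal.subst θ.toFun),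
        V ∪ ↑(r.rename ρ).vars ∪ θ.vars, σ.comp θ⟩ ∧
      Query.Foreseen (adornedPreds P R) 𝒜 μ Y.goal ∧
      Step (extendedProgram P R 𝒜) ⟨.atom A :: G, V, σ⟩ Y := by
  have hbody : ((r.rename ρ).body ++ Query.erase G).map (Literal.subst θ.toFun) =
      Query.subst (fun x => θ.toFun (ρ x)) r.body ++ Query.subst θ.toFun (Query.erase G) := by
    refine (Query.subst_append _ _ _).trans (congrArg (· ++ _) ?_)
    exact Query.subst_subst _ _ _
  obtain ⟨r', hr', rfl, hrel, hfore⟩ := exists_adorned_rule h𝒜 hcall hr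
    (hθ.1.trans (Atom.subst_subst _ _ _)) hμ (hbody ▸ hrun) hA hinl
  rw [← Clause.erase_rename] at hθ
  rw [← Clause.erase_rename, Clause.vars_erase] at hfresh
  refine ⟨_, ?_, ?_, Step.resolve A G V σ θ r' ρ (Or.inl hr') hfresh
    ((isMGU_erase_iff (B := (r'.rename ρ).head) hrel.symm).1 hθ)⟩
  · rw [← Clause.erase_rename, Clause.vars_erase]
    refine Config.mk.injEq .. ▸ ⟨(Query.erase_subst _ _).trans ?_, rfl, rfl⟩
    rw [Query.erase_append]
    rfl
  · intro B hB
    change Literal.atom B ∈ Query.subst _ _ at hB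
    rw [Query.subst_append] at hB
    rcases List.mem_append.1 hB with hB | hB
    · refine hfore B ?_
      convert hB using 1
      exact (Query.subst_subst _ _ _).symm
    · exact hG.subst B hB

/-- Every step of the original program that does not run into a failing prefix is matched by one
or two steps of the extended program, and correctness of the adornments is maintained. -/
theorem Step.exists_extended
    (h𝒜 : ∀ q ∈ adornedPreds P R, IsSetOfAdornments P Q q (𝒜 q)) {C D : Config F ar}
    (hC : Reachable P Q C) (h : Step P C D) :
    ∃ θ : Subst F, ∀ μ, IsProphecy μ → Query.RunsTrue D.goal →
      ∀ X : Config F (adAr ar), X.erase = C →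
        Query.Foreseen (adornedPreds P R) 𝒜 (pullProphecy θ.toFun μ) X.goal →
        ∃ Y : Config F (adAr ar), Y.erase = D ∧
          Query.Foreseen (adornedPreds P R) 𝒜 μ Y.goal ∧
          ∃ Z, Relation.TransGen (Step (extendedProgram P R 𝒜)) X Z ∧
            Z.Variant (Query.vars Q) Y := by
  have hwf := Reachable.wf hC
  cases h with
  | resolve A G V σ θ r ρ hr hfresh hθ =>
    refine ⟨θ, fun μ hμ hrun X hX hfore => ?_⟩
    obtain ⟨G', V', σ'⟩ := X
    obtain ⟨hG', rfl, rfl⟩ := Config.mk.inj hX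
    rcases G' with _ | ⟨A' | _ | _, G'⟩ <;>
      simp only [Query.erase, List.map_cons, List.map_nil, Literal.erase, List.cons.injEq,
        Literal.atom.injEq, reduceCtorEq, false_and] at hG'
    obtain ⟨rfl, rfl⟩ := hG'
    have hcall : IsCall P Q A'.erase := ⟨_, hC, _, rfl⟩
    have hA' := hfore A' List.mem_cons_self
    have hG : Query.Foreseen (adornedPreds P R) 𝒜 (pullProphecy θ.toFun μ) G' :=
      fun B hB => hfore B (List.mem_cons_of_mem _ hB)
    have hwfX : Config.WF (Query.vars Q) ⟨.atom A' :: G', V', σ'⟩ := Config.wf_erase_iff.1 hwf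
    by_cases hinl : ∀ q, A'.rel = .inl q → q ∉ adornedPreds P R
    · obtain ⟨Y, hY, hYfore, hstep⟩ := exists_adorned_step h𝒜 (σ := σ') hcall hr hfresh hθ hμ hrun
        hA' hG hinl
      exact ⟨Y, hY, hYfore, Y, .single hstep, Config.Variant.refl _ _⟩
    · push Not at hinl
      obtain ⟨q, hrel, hq⟩ := hinl
      obtain ⟨q', args⟩ := A'
      obtain rfl : q' = .inl q := hrel
      -- The adornment is the one that is true of the foreseen values of the arguments.
      obtain ⟨ν, hν⟩ := hμ.exists_assignment θ.toFun
      obtain ⟨c, hc, hH⟩ := (h𝒜 q hq).2.2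
        fun i => (Term.eval (fun v => some (ν v)) (args i)).getD 0
      obtain ⟨Z, hZ, hZv⟩ := exists_bridging_step hwfX hq hc
      have hA'' : Atom.Foreseen (adornedPreds P R) 𝒜 (pullProphecy θ.toFun μ)
          (⟨.inr ⟨q, c⟩, args⟩ : Atom F (adAr ar)) := by
        refine ⟨hq, hc, _, fun i k z hz => ?_, hH⟩
        have : ((args i).subst θ.toFun).eval (μ k) = some z := by
          rw [Term.eval_subst]
          refine Term.eval_mono (fun x w hw => ?_) hz
          cases k with
          | zero => simp [pullProphecy] at hw
          | succ k => exact hμ.eval_mono (Nat.le_succ k) hw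
        exact congrArg (fun o : Option ℤ => o.getD 0) (hν _ _ _ this)
      obtain ⟨Y, hY, hYfore, hstep⟩ := exists_adorned_step h𝒜 (σ := σ')
        (A := ⟨.inr ⟨q, c⟩, args⟩) hcall hr hfresh hθ hμ hrun hA'' hG (by simp)
      obtain ⟨Z', hZ', hZ'v⟩ := hstep.exists_variant hZv (hZ.wf hwfX)
        ⟨hwf.finite, fun x hx => hwfX.goal x hx, hwf.answer⟩
      exact ⟨Y, hY, hYfore, Z', .tail (.single hZ) hZ', hZ'v⟩
  | cmp c a b x y G V σ ha hb hc =>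
    refine ⟨Subst.id, fun μ hμ hrun X hX hfore => ?_⟩
    obtain ⟨G', V', σ'⟩ := X
    obtain ⟨hG', rfl, rfl⟩ := Config.mk.inj hX
    rcases G' with _ | ⟨_ | ⟨c', a', b'⟩ | _, G'⟩ <;>
      simp only [Query.erase, List.map_cons, List.map_nil, Literal.erase, List.cons.injEq,
        Literal.cmp.injEq, reduceCtorEq, false_and] at hG'
    obtain ⟨⟨rfl, rfl, rfl⟩, rfl⟩ := hG'
    refine ⟨⟨G', V', σ'⟩, rfl, ?_, _, .single (.cmp _ _ _ x y G' V' σ' ha hb hc),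
      Config.Variant.refl _ _⟩
    have := Query.Foreseen.subst (θ := Subst.id.toFun) (G := G')
      fun B hB => hfore B (List.mem_cons_of_mem _ hB)
    rwa [show Query.subst Subst.id.toFun G' = G' from Query.subst_var G'] at this
  | assign t e z G V σ θ he hθ =>
    refine ⟨θ, fun μ hμ hrun X hX hfore => ?_⟩
    obtain ⟨G', V', σ'⟩ := X
    obtain ⟨hG', rfl, rfl⟩ := Config.mk.inj hX
    rcases G' with _ | ⟨_ | _ | ⟨t', e'⟩, G'⟩ <;>
      simp only [Query.erase, List.map_cons, List.map_nil, Literal.erase, List.cons.injEq,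
        Literal.assign.injEq, reduceCtorEq, false_and] at hG'
    obtain ⟨⟨rfl, rfl⟩, rfl⟩ := hG'
    refine ⟨_, ?_, ?_, _, .single (.assign _ _ z G' V' σ' θ he hθ), Config.Variant.refl _ _⟩
    · exact Config.mk.injEq .. ▸ ⟨Query.erase_subst _ _, rfl, rfl⟩
    · exact Query.Foreseen.subst fun B hB => hfore B (List.mem_cons_of_mem _ hB)

/-! ### Complete derivations -/

/-- A successful or infinite LD-derivation, as an infinite sequence: a successful derivation is
continued by repeating its last stage. -/
structure IsRun (P : Program F ar) (Q : Query F ar) (C : ℕ → Config F ar) : Prop where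
  zero : C 0 = Config.init Q
  succ : ∀ n, Step P (C n) (C (n + 1)) ∨ ((C n).goal = [] ∧ C (n + 1) = C n)

theorem IsRun.reachable {C : ℕ → Config F ar} (h : IsRun P Q C) (n : ℕ) :
    Reachable P Q (C n) := by
  induction n with
  | zero => rw [h.zero]; exact .refl
  | succ n ih =>
    rcases h.succ n with hs | ⟨-, he⟩
    · exact Relation.ReflTransGen.tail ih hs
    · rwa [he]

/-- Comparisons that start a goal are executed before anything else, and a run does not stop at
them. -/
theorem IsRun.runsTrue {C : ℕ → Config F ar} (h : IsRun P Q C) (n : ℕ) :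
    Query.RunsTrue (C n).goal := by
  intro pre
  induction pre generalizing n with
  | nil => simp
  | cons L pre ih =>
    intro rest hgoal hcmp c a b hmem
    obtain ⟨c', a', b', rfl⟩ := hcmp L List.mem_cons_self
    rcases h.succ n with hs | ⟨hnil, -⟩
    · generalize C n = X at hs hgoal
      have ih := ih (n + 1)
      generalize C (n + 1) = Y at hs ih
      cases hs with
      | cmp c'' a'' b'' x y G V σ ha hb hc =>
        obtain ⟨hL, hG⟩ := List.cons.inj hgoal
        obtain ⟨rfl, rfl, rfl⟩ := Literal.cmp.inj hL
        rcases List.mem_cons.1 hmem with hmem | hmem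
        · obtain ⟨rfl, rfl, rfl⟩ := Literal.cmp.inj hmem
          exact ⟨x, y, ha, hb, hc⟩
        · exact ih rest hG (fun L hL => hcmp L (List.mem_cons_of_mem _ hL)) c a b hmem
      | _ => simp at hgoal
    · rw [hnil] at hgoal
      simp at hgoal

theorem Reachable.exists_run {C : Config F ar} (h : Reachable P Q C) (hgoal : C.goal = []) :
    ∃ S : ℕ → Config F ar, IsRun P Q S ∧ ∃ N, S N = C := by
  suffices ∀ D, Relation.ReflTransGen (Step P) D C → ∃ S : ℕ → Config F ar, S 0 = D ∧
      (∀ n, Step P (S n) (S (n + 1)) ∨ ((S n).goal = [] ∧ S (n + 1) = S n)) ∧ ∃ N, S N = C by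
    obtain ⟨S, h0, hs, hN⟩ := this _ h
    exact ⟨S, ⟨h0, hs⟩, hN⟩
  intro D hD
  induction hD using Relation.ReflTransGen.head_induction_on with
  | refl => exact ⟨fun _ => C, rfl, fun _ => Or.inr ⟨hgoal, rfl⟩, 0, rfl⟩
  | @head D E hs _ ih =>
    obtain ⟨S, rfl, hS, N, hN⟩ := ih
    refine ⟨fun n => n.casesOn D S, rfl, fun n => ?_, N + 1, hN⟩
    cases n with
    | zero => exact Or.inl hs
    | succ n => exact hS n

/-- The prophecy along a sequence of unifiers: at accuracy `k` the next `k` of them are taken into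
account. -/
def prophecy (θ : ℕ → Subst F) : ℕ → ℕ → ℕ → Option ℤ
  | _, 0, _ => none
  | n, k + 1, x => ((θ n).toFun x).eval (prophecy θ (n + 1) k)

theorem isProphecy_prophecy (θ : ℕ → Subst F) (n : ℕ) : IsProphecy (prophecy θ n) := by
  intro k
  induction k generalizing n with
  | zero => simp [prophecy]
  | succ k ih => exact fun x z hz => Term.eval_mono (ih (n + 1)) hz

theorem pullProphecy_prophecy (θ : ℕ → Subst F) (n : ℕ) :
    pullProphecy (θ n).toFun (prophecy θ (n + 1)) = prophecy θ n := by
  funext k x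
  cases k <;> rfl

theorem Config.Variant.exists_transGen {P : Program F ar} {V₀ : Finset ℕ} {C C' D' : Config F ar}
    (hv : C.Variant V₀ C') (hC : C.WF V₀) (hC' : C'.WF V₀)
    (h : Relation.TransGen (Step P) C' D') :
    ∃ D, Relation.TransGen (Step P) C D ∧ D.Variant V₀ D' ∧ D.WF V₀ := by
  suffices ∃ D, Relation.TransGen (Step P) C D ∧ D.Variant V₀ D' ∧ D.WF V₀ ∧ D'.WF V₀ by
    obtain ⟨D, h1, h2, h3, -⟩ := this
    exact ⟨D, h1, h2, h3⟩
  induction h with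
  | single hs =>
    obtain ⟨D, hD, hDv⟩ := hs.exists_variant hv hC hC'
    exact ⟨D, .single hD, hDv, hD.wf hC, hs.wf hC'⟩
  | tail _ hs ih =>
    obtain ⟨D, hD, hDv, hDwf, hDwf'⟩ := ih
    obtain ⟨E, hE, hEv⟩ := hs.exists_variant hDv hDwf hDwf'
    exact ⟨E, hD.tail hE, hEv, hE.wf hDwf, hs.wf hDwf'⟩

/-- A successful or infinite derivation of the original program is followed, stage by stage, by a
derivation of the extended program that keeps a property `I n` at stage `n`. -/
theorem IsRun.exists_simulation
    (h𝒜 : ∀ q ∈ adornedPreds P R, IsSetOfAdornments P Q q (𝒜 q)) {C : ℕ → Config F ar}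
    (h : IsRun P Q C) : ∃ I : ℕ → Config F (adAr ar) → Prop,
      I 0 (Config.init (Query.embed Q)) ∧ (∀ n C', I n C' → Simulates (Query.vars Q) (C n) C') ∧
      ∀ n C', I n C' → (I (n + 1) C' ∧ (C n).goal = []) ∨
        ∃ D', Relation.TransGen (Step (extendedProgram P R 𝒜)) C' D' ∧ I (n + 1) D' := by
  have hstep : ∀ n, ∃ θ : Subst F, ∀ μ, IsProphecy μ →
      ∀ X : Config F (adAr ar), X.erase = C n →
        Query.Foreseen (adornedPreds P R) 𝒜 (pullProphecy θ.toFun μ) X.goal →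
        ((C n).goal = [] ∧ C (n + 1) = C n) ∨ ∃ Y : Config F (adAr ar), Y.erase = C (n + 1) ∧
          Query.Foreseen (adornedPreds P R) 𝒜 μ Y.goal ∧
          ∃ Z, Relation.TransGen (Step (extendedProgram P R 𝒜)) X Z ∧
            Z.Variant (Query.vars Q) Y := by
    intro n
    rcases h.succ n with hs | hs
    · obtain ⟨θ, hθ⟩ := hs.exists_extended h𝒜 (h.reachable n)
      exact ⟨θ, fun μ hμ X hX hfore => Or.inr (hθ μ hμ (h.runsTrue (n + 1)) X hX hfore)⟩
    · exact ⟨Subst.id, fun μ hμ X hX hfore => Or.inl hs⟩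
  choose θ hθ using hstep
  -- The invariant: up to variants, `C'` is `C n` with adornments that are correct for the prophecy
  -- along the unifiers from stage `n` onwards.
  refine ⟨fun n C' => C'.WF (Query.vars Q) ∧ ∃ X : Config F (adAr ar), X.erase = C n ∧
    Query.Foreseen (adornedPreds P R) 𝒜 (prophecy θ n) X.goal ∧ X.Variant (Query.vars Q) C',
    ⟨Query.vars_embed Q ▸ Config.WF.init _, _,
      (Config.erase_init_embed Q).trans h.zero.symm, ?_, Config.Variant.refl _ _⟩,
    fun n C' ⟨_, X, hX, _, hv⟩ => ⟨X, hX, hv⟩, ?_⟩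
  · intro A hA
    obtain ⟨L, -, hL⟩ := List.mem_map.1 hA
    cases L with
    | atom B =>
      obtain rfl := Literal.atom.inj hL
      trivial
    | _ => simp [Literal.embed] at hL
  · rintro n C' ⟨hwf, X, hX, hfore, hv⟩
    rcases hθ n _ (isProphecy_prophecy θ (n + 1)) X hX
      ((pullProphecy_prophecy θ n).symm ▸ hfore) with ⟨hnil, he⟩ | ⟨Y, hY, hYfore, Z, hZ, hZv⟩
    · refine Or.inl ⟨⟨hwf, X, hX.trans he.symm, ?_, hv⟩, hnil⟩
      have : X.goal = [] := List.map_eq_nil_iff.1 ((congrArg Config.goal hX).trans hnil)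
      rw [this]
      exact fun A hA => absurd hA List.not_mem_nil
    · obtain ⟨D', hD', hDv, hDwf⟩ := Config.Variant.exists_transGen hv.symm hwf
        (Config.wf_erase_iff.1 (hX ▸ Reachable.wf (h.reachable n))) hZ
      exact Or.inr ⟨D', hD', hDwf, Y, hY, hYfore, (hDv.trans hZv).symm⟩

theorem IsComputedAnswer.extendedProgram
    (h𝒜 : ∀ q ∈ adornedPreds P R, IsSetOfAdornments P Q q (𝒜 q)) {σ : Subst F}
    (h : IsComputedAnswer P Q σ) :
    IsComputedAnswer (extendedProgram P R 𝒜) (Query.embed Q) σ := by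
  obtain ⟨C, hC, hgoal, rfl⟩ := h
  obtain ⟨S, hS, N, rfl⟩ := Reachable.exists_run hC hgoal
  obtain ⟨I, hI0, hIsim, hIstep⟩ := hS.exists_simulation h𝒜
  have : ∀ n, ∃ C', Reachable (LogicProg.extendedProgram P R 𝒜) (Query.embed Q) C' ∧ I n C' := by
    intro n
    induction n with
    | zero => exact ⟨_, .refl, hI0⟩
    | succ n ih =>
      obtain ⟨C', hC', hI⟩ := ih
      rcases hIstep n C' hI with ⟨hI', -⟩ | ⟨D', hD', hI'⟩
      · exact ⟨C', hC', hI'⟩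
      · exact ⟨D', Relation.ReflTransGen.trans hC' hD'.to_reflTransGen, hI'⟩
  obtain ⟨C', hC', hI⟩ := this N
  obtain ⟨X, hX, hv⟩ := hIsim N C' hI
  have hXgoal : X.goal = [] := List.map_eq_nil_iff.1 ((congrArg Config.goal hX).trans hgoal)
  have hans : X.answer = (S N).answer := congrArg Config.answer hX
  rw [← hans, ← Query.vars_embed Q]
  refine IsComputedAnswer.of_variant (Query.vars_embed Q ▸ hv.symm) hC' ?_ fun h => ?_
  · obtain ⟨η, -, h⟩ := hv.1
    rw [h, hXgoal]
    rfl
  · rw [hans]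
    exact hC.answer_eq_id (Query.isCmp_of_embed h)

theorem HasInfiniteDerivation.extendedProgram
    (h𝒜 : ∀ q ∈ adornedPreds P R, IsSetOfAdornments P Q q (𝒜 q))
    (h : HasInfiniteDerivation P Q) :
    HasInfiniteDerivation (extendedProgram P R 𝒜) (Query.embed Q) := by
  obtain ⟨C, h0, hs⟩ := h
  have hnil : ∀ n, (C n).goal ≠ [] := by
    intro n hn
    have := hs n
    generalize C n = X at this hn
    generalize C (n + 1) = Y at this
    cases this <;> simp at hn
  obtain ⟨I, hI0, -, hIstep⟩ :=
    IsRun.exists_simulation h𝒜 (C := C) ⟨h0, fun n => Or.inl (hs n)⟩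
  rw [hasInfiniteDerivation_iff]
  intro hacc
  suffices ∀ C', Acc (Relation.TransGen (flip (Step (LogicProg.extendedProgram P R 𝒜)))) C' →
      ∀ n, ¬ I n C' from this _ hacc.transGen 0 hI0
  intro C' hC'
  induction hC' with
  | intro C' _ ih =>
    intro n hI
    rcases hIstep n C' hI with ⟨-, hn⟩ | ⟨D', hD', hI'⟩
    · exact hnil n hn
    · exact ih D' (Relation.transGen_swap.2 hD') (n + 1) hI'

end

end LogicProg

theorem mainTheorem1 {F : Type*} {Pr : Type*} {ar : Pr → ℕ}
    (P : LogicProg.Program F ar) (Q : LogicProg.Query F ar)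
    (R : Set Pr) (𝒜 : (q : Pr) → Finset (LogicProg.SymCond (ar q)))
    (h𝒜 : ∀ q ∈ LogicProg.adornedPreds P R, LogicProg.IsSetOfAdornments P Q q (𝒜 q)) :
    LogicProg.bossiCocco P Q =
      LogicProg.bossiCocco (LogicProg.extendedProgram P R 𝒜) (LogicProg.Query.embed Q) := by
  have hans : ∀ σ, LogicProg.IsComputedAnswer P Q σ ↔ LogicProg.IsComputedAnswer
      (LogicProg.extendedProgram P R 𝒜) (LogicProg.Query.embed Q) σ := fun σ =>
    ⟨fun h => h.extendedProgram h𝒜, fun h => h.of_extendedProgram⟩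
  have hinf : LogicProg.HasInfiniteDerivation P Q ↔ LogicProg.HasInfiniteDerivation
      (LogicProg.extendedProgram P R 𝒜) (LogicProg.Query.embed Q) :=
    ⟨fun h => h.extendedProgram h𝒜, fun h => h.of_extendedProgram⟩
  simp only [LogicProg.bossiCocco, hans, hinf]
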